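/- Let $\mathcal{V}$ be the twisted Heisenberg–Virasoro algebra: the complex Lie algebra with basis $\{z_1,z_2,z_3\}\cup\{L_k,I_k : k\in\mathbb{Z}\}$ and bracket $$[L_k,L_j]=(j-k)L_{k+j}+\delta_{j,-k}\tfrac{k^3-k}{12}z_1,\quad [L_k,I_j]=jI_{k+j}+\delta_{j,-k}(k^2-k)z_2,\quad [I_k,I_j]=\delta_{j,-k}\,k\,z_3,\quad [z_i,\mathcal{V}]=0 .$$ Let $\mathfrak{n}^+=\mathrm{span}_{\mathbb{C}}\{L_k,I_k : k\ge 1\}$, and let $\psi:\mathfrak{n}^+\to\mathbb{C}$ be a Lie algebra homomorphism that is nonsingular, i.e. $\psi(L_1),\psi(L_2),\psi(I_1)\neq 0$. Let $\mathbb{C}_\psi$ be the one-dimensional $\mathfrak{n}^+$-module on which $x\in\mathfrak{n}^+$ acts as the scalar $\psi(x)$, let $M_\psi=U(\mathcal{V})\otimes_{U(\mathfrak{n}^+)}\mathbb{C}_\psi$ be the universal Whittaker module, and let $w=1\otimes 1\in M_\psi$. Put $z_0=I_0$; the elements $z_0,z_1,z_2,z_3$ are central in $U(\mathcal{V})$.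 If $w'\in M_\psi$ is a Whittaker vector of type $\psi$, i.e. $xw'=\psi(x)w'$ for all $x\in\mathfrak{n}^+$, then $w'=p(z)w$ for some polynomial $p(z)=p(z_0,z_1,z_2,z_3)$ with complex coefficients. -/

import Mathlib

/-- Labels of the standard basis of the twisted Heisenberg–Virasoro algebra: `L k` and `I k` for
`k : ℤ`, and three central elements `z 0`, `z 1`, `z 2`, standing for `z₁`, `z₂`, `z₃`. -/
inductive HVIndex : Type
  | L : ℤ → HVIndex
  | I : ℤ → HVIndex
  | z : Fin 3 → HVIndex

/-- The twisted Heisenberg–Virasoro algebra over `ℂ`: the complex vector space with basis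
`L k`, `I k` (`k : ℤ`), `z₁`, `z₂`, `z₃`. Its bracket is defined below. -/
def HV : Type := HVIndex →₀ ℂ

namespace HV

noncomputable instance : AddCommGroup HV := inferInstanceAs (AddCommGroup (HVIndex →₀ ℂ))

noncomputable instance : Module ℂ HV := inferInstanceAs (Module ℂ (HVIndex →₀ ℂ))

/-- The basis vector with a given label. -/
noncomputable def e (i : HVIndex) : HV := Finsupp.single i 1

/-- The element `L_k`. -/
noncomputable def L (k : ℤ) : HV := e (HVIndex.L k)

/-- The element `I_k`. -/
noncomputable def I (k : ℤ) : HV := e (HVIndex.I k)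

/-- The central elements `z₁ = z 0`, `z₂ = z 1`, `z₃ = z 2`. -/
noncomputable def z (i : Fin 3) : HV := e (HVIndex.z i)

/-- The bracket of two basis vectors. The value for `(I k, L j)` is minus the one for
`(L j, I k)`. -/
noncomputable def basisBracket : HVIndex → HVIndex → HV
  | .L k, .L j => ((j : ℂ) - k) • L (k + j)
      + (if j = -k then ((k : ℂ) ^ 3 - k) / 12 else 0) • z 0
  | .L k, .I j => (j : ℂ) • I (k + j) + (if j = -k then (k : ℂ) ^ 2 - k else 0) • z 1
  | .I k, .L j => -((k : ℂ) • I (j + k) + (if k = -j then (j : ℂ) ^ 2 - j else 0) • z 1)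
  | .I k, .I j => (if j = -k then (k : ℂ) else 0) • z 2
  | .z _, _ => 0
  | _, .z _ => 0

/-- The bilinear extension of `basisBracket`. -/
noncomputable def bracketMap : HV →ₗ[ℂ] HV →ₗ[ℂ] HV :=
  Finsupp.linearCombination ℂ fun i => (Finsupp.linearCombination ℂ (basisBracket i) : HV →ₗ[ℂ] HV)

theorem bracketMap_e (i j : HVIndex) : bracketMap (e i) (e j) = basisBracket i j := by
  have h : bracketMap (e i) = (Finsupp.linearCombination ℂ (basisBracket i) : HV →ₗ[ℂ] HV) :=
    (Finsupp.linearCombination_single ℂ (1 : ℂ) i).trans (one_smul _ _)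
  rw [h]
  exact (Finsupp.linearCombination_single ℂ (1 : ℂ) j).trans (one_smul _ _)

theorem hom_ext_e {M : Type*} [AddCommMonoid M] [Module ℂ M] {f g : HV →ₗ[ℂ] M}
    (h : ∀ i, f (e i) = g (e i)) : f = g :=
  Finsupp.lhom_ext' fun i => LinearMap.ext_ring (h i)

theorem basisBracket_skew (i j : HVIndex) : basisBracket i j = -basisBracket j i := by
  rcases i with k | k | a <;> rcases j with j | j | b <;> simp only [basisBracket, neg_neg, neg_zero]
  · by_cases h : j = -k
    · subst h
      simp only [neg_neg, if_true, add_comm (-k) k, ← neg_smul, neg_add]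
      congr 2 <;> push_cast <;> ring
    · have h' : k ≠ -j := fun h' => h (by omega)
      simp only [h, h', if_false, zero_smul, add_zero, add_comm j k, ← neg_smul]
      congr 1; ring
  · by_cases h : j = -k
    · subst h; simp
    · have h' : k ≠ -j := fun h' => h (by omega)
      simp [h, h']

theorem bracketMap_skew (x y : HV) : bracketMap x y = -bracketMap y x := by
  have h : bracketMap = -bracketMap.flip :=
    hom_ext_e fun i => hom_ext_e fun j => by
      simpa [bracketMap_e] using basisBracket_skew i j
  exact congrArg (fun f => f x y) h

theorem bracketMap_jacobi_e (i j k : HVIndex) :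
    bracketMap (e i) (basisBracket j k) =
      bracketMap (basisBracket i j) (e k) + bracketMap (e j) (basisBracket i k) := by
  rcases i with a | a | a <;> rcases j with b | b | b <;> rcases k with c | c | c <;>
    simp only [basisBracket, L, I, z, map_add, map_neg, map_smul, map_zero, LinearMap.add_apply,
      LinearMap.neg_apply, LinearMap.smul_apply, LinearMap.zero_apply, bracketMap_e, smul_zero,
      neg_zero, add_zero, zero_add]
  all_goals
    try rw [show b + (a + c) = a + (b + c) by ring]
    try rw [show a + b + c = a + (b + c) by ring]
    try rw [show c + (a + b) = a + (b + c) by ring]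
    try rw [show a + (c + b) = a + (b + c) by ring]
    try rw [show b + (c + a) = a + (b + c) by ring]
    try rw [show a + c + b = a + (b + c) by ring]
    try rw [show c + (b + a) = a + (b + c) by ring]
    try rw [show b + c + a = a + (b + c) by ring]
    by_cases h : a + b + c = 0
    · obtain rfl : c = -a - b := by omega
      try simp only [show ((-a - b : ℤ) : ℂ) = -a - b by push_cast; ring]
      split_ifs <;> first | (exfalso; omega) | (match_scalars <;> ring)
    · split_ifs <;> first | (exfalso; omega) | (match_scalars <;> ring)

theorem induction_e {p : HV → Prop} (x : HV) (zero : p 0) (add : ∀ x y, p x → p y → p (x + y))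
    (smul : ∀ (t : ℂ) i, p (t • e i)) : p x := by
  refine Finsupp.induction_linear (motive := p) x zero add fun i t => ?_
  have h : (Finsupp.single i t : HVIndex →₀ ℂ) = t • Finsupp.single i 1 := by simp
  rw [h]
  exact smul t i

theorem bracketMap_jacobi (x y w : HV) :
    bracketMap x (bracketMap y w) =
      bracketMap (bracketMap x y) w + bracketMap y (bracketMap x w) := by
  induction x using induction_e with
  | zero => simp
  | add x x' h h' => simp only [map_add, LinearMap.add_apply, h, h']; abel
  | smul r i =>
  induction y using induction_e with
  | zero => simp
  | add y y' h h' => simp only [map_add, LinearMap.add_apply, h, h']; abel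
  | smul s j =>
  induction w using induction_e with
  | zero => simp
  | add w w' h h' => simp only [map_add, h, h']; abel
  | smul t k =>
  have h := bracketMap_jacobi_e i j k
  simp only [map_smul, LinearMap.smul_apply, bracketMap_e]
  rw [h]
  module

noncomputable instance : LieRing HV where
  bracket x y := bracketMap x y
  add_lie x y w := by simp
  lie_add x y w := by simp
  lie_self x := by
    have h : bracketMap x x = -bracketMap x x := bracketMap_skew x x
    have h2 : (2 : ℂ) • bracketMap x x = 0 := by
      rw [two_smul]; nth_rewrite 1 [h]; exact neg_add_cancel _
    exact (smul_eq_zero.mp h2).resolve_left two_ne_zero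
  leibniz_lie := bracketMap_jacobi

noncomputable instance : LieAlgebra ℂ HV :=
  { (inferInstance : Module ℂ HV) with
    lie_smul := fun t x y => (bracketMap x).map_smul t y }

theorem lie_e (i j : HVIndex) : ⁅e i, e j⁆ = basisBracket i j := bracketMap_e i j

theorem lie_L_L (k j : ℤ) : ⁅L k, L j⁆ = ((j : ℂ) - k) • L (k + j)
    + (if j = -k then ((k : ℂ) ^ 3 - k) / 12 else 0) • z 0 := lie_e _ _

theorem lie_L_I (k j : ℤ) : ⁅L k, I j⁆ = (j : ℂ) • I (k + j)
    + (if j = -k then (k : ℂ) ^ 2 - k else 0) • z 1 := lie_e _ _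

theorem lie_I_I (k j : ℤ) : ⁅I k, I j⁆ = (if j = -k then (k : ℂ) else 0) • z 2 := lie_e _ _

theorem lie_z (i : Fin 3) (x : HV) : ⁅z i, x⁆ = 0 := by
  have h : bracketMap (z i) = 0 := hom_ext_e fun j => (bracketMap_e _ j).trans (by cases j <;> rfl)
  exact congrArg (fun f => f x) h

theorem lie_I_zero (x : HV) : ⁅I 0, x⁆ = 0 := by
  have h : bracketMap (I 0) = 0 := hom_ext_e fun j => (bracketMap_e _ j).trans (by
    rcases j with j | j | j <;> simp only [basisBracket, LinearMap.zero_apply]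
    · by_cases h : j = 0
      · simp [h]
      · have h' : (0 : ℤ) ≠ -j := by omega
        simp [h']
    · simp)
  exact congrArg (fun f => f x) h

/-- The spanning set of `𝔫⁺`: all `L k` and `I k` with `k ≥ 1`. -/
def posGenerators : Set HV := {x | ∃ k : ℤ, 0 < k ∧ (x = L k ∨ x = I k)}

theorem lie_mem_span_posGenerators {x y : HV} (hx : x ∈ Submodule.span ℂ posGenerators)
    (hy : y ∈ Submodule.span ℂ posGenerators) : ⁅x, y⁆ ∈ Submodule.span ℂ posGenerators := by
  have hL : ∀ k : ℤ, 0 < k → L k ∈ Submodule.span ℂ posGenerators :=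
    fun k hk => Submodule.subset_span ⟨k, hk, Or.inl rfl⟩
  have hI : ∀ k : ℤ, 0 < k → I k ∈ Submodule.span ℂ posGenerators :=
    fun k hk => Submodule.subset_span ⟨k, hk, Or.inr rfl⟩
  induction hx, hy using Submodule.span_induction₂ with
  | mem_mem x y hx hy =>
    obtain ⟨k, hk, hx⟩ := hx
    obtain ⟨j, hj, hy⟩ := hy
    have h : j ≠ -k := by omega
    have h' : k ≠ -j := by omega
    rcases hx with rfl | rfl <;> rcases hy with rfl | rfl
    · simpa only [lie_L_L, h, if_false, zero_smul, add_zero]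
        using Submodule.smul_mem _ _ (hL _ (by omega))
    · simpa only [lie_L_I, h, if_false, zero_smul, add_zero]
        using Submodule.smul_mem _ _ (hI _ (by omega))
    · rw [← lie_skew]
      simpa only [lie_L_I, h', if_false, zero_smul, add_zero]
        using Submodule.neg_mem _ (Submodule.smul_mem _ _ (hI _ (by omega)))
    · simp only [lie_I_I, h, if_false, zero_smul, Submodule.zero_mem]
  | zero_left y hy => simp
  | zero_right x hx => simp
  | add_left x y w _ _ _ h h' => rw [add_lie]; exact Submodule.add_mem _ h h'
  | add_right x y w _ _ _ h h' => rw [lie_add]; exact Submodule.add_mem _ h h'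
  | smul_left r x y _ _ h => rw [smul_lie]; exact Submodule.smul_mem _ r h
  | smul_right r x y _ _ h => rw [lie_smul]; exact Submodule.smul_mem _ r h

/-- The Lie subalgebra `𝔫⁺`, the span of all `L k` and `I k` with `k ≥ 1`. -/
noncomputable def nPlus : LieSubalgebra ℂ HV where
  toSubmodule := Submodule.span ℂ posGenerators
  lie_mem' := lie_mem_span_posGenerators

/-- `L k` as an element of `𝔫⁺`, for `k ≥ 1`. -/
noncomputable def posL (k : ℤ) (hk : 0 < k) : nPlus :=
  ⟨L k, Submodule.subset_span ⟨k, hk, Or.inl rfl⟩⟩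

/-- `I k` as an element of `𝔫⁺`, for `k ≥ 1`. -/
noncomputable def posI (k : ℤ) (hk : 0 < k) : nPlus :=
  ⟨I k, Submodule.subset_span ⟨k, hk, Or.inr rfl⟩⟩

/-- A Lie algebra homomorphism `ψ : 𝔫⁺ → ℂ` is nonsingular if it does not vanish on any of the
generators `L 1`, `L 2`, `I 1` of `𝔫⁺`. -/
def IsNonsingular (ψ : LieAlgebra.LieCharacter ℂ nPlus) : Prop :=
  ψ (posL 1 one_pos) ≠ 0 ∧ ψ (posL 2 two_pos) ≠ 0 ∧ ψ (posI 1 one_pos) ≠ 0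

/-- The universal enveloping algebra of the twisted Heisenberg–Virasoro algebra. -/
abbrev U : Type := UniversalEnvelopingAlgebra ℂ HV

/-- The universal enveloping algebra of `𝔫⁺`. -/
abbrev UPlus : Type := UniversalEnvelopingAlgebra ℂ nPlus

section

attribute [local instance 100] LieRing.ofAssociativeRing

/-- The algebra homomorphism `U(𝔫⁺) → U(𝒱)` induced by the inclusion. -/
noncomputable def uPlusMap : UPlus →ₐ[ℂ] U :=
  UniversalEnvelopingAlgebra.lift ℂ ((UniversalEnvelopingAlgebra.ι ℂ).comp nPlus.incl)

/-- The algebra homomorphism `U(𝔫⁺) → ℂ` induced by `ψ`. -/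
noncomputable def charLift (ψ : LieAlgebra.LieCharacter ℂ nPlus) : UPlus →ₐ[ℂ] ℂ :=
  UniversalEnvelopingAlgebra.lift ℂ ψ

end

/-- The vector space `ℂ` regarded as the one-dimensional `𝔫⁺`-module `ℂ_ψ`. -/
def CPsi (_ψ : LieAlgebra.LieCharacter ℂ nPlus) : Type := ℂ

namespace CPsi

variable (ψ : LieAlgebra.LieCharacter ℂ nPlus)

noncomputable instance : AddCommGroup (CPsi ψ) := inferInstanceAs (AddCommGroup ℂ)

noncomputable instance : Module ℂ (CPsi ψ) := inferInstanceAs (Module ℂ ℂ)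

/-- `U(𝔫⁺)` acts on `ℂ_ψ` through `U(𝔫⁺) → ℂ`, so that `x ∈ 𝔫⁺` acts as the scalar `ψ x`. -/
noncomputable instance : Module UPlus (CPsi ψ) := Module.compHom ℂ (charLift ψ).toRingHom

/-- The basis vector `1` of `ℂ_ψ`. -/
noncomputable def one : CPsi ψ := (1 : ℂ)

theorem ι_smul (x : nPlus) (a : CPsi ψ) : UniversalEnvelopingAlgebra.ι ℂ x • a = ψ x • a :=
  congrArg (fun t : ℂ => t • a) (UniversalEnvelopingAlgebra.lift_ι_apply ℂ ψ x)

end CPsi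

open scoped TensorProduct in
/-- The relations `b a ⊗ n = b ⊗ a n` (`b ∈ B`, `a ∈ A`, `n ∈ N`) that turn the tensor product of
`B` and `N` over `ℂ` into the tensor product over the (noncommutative) `ℂ`-algebra `A`, where `A`
acts on `B` from the right through `φ : A → B`. Their set is stable under left multiplication
by `B`. -/
def balancedRelations {A B : Type} [Ring A] [Algebra ℂ A] [Ring B] [Algebra ℂ B] (φ : A →ₐ[ℂ] B)
    (N : Type) [AddCommGroup N] [Module ℂ N] [Module A N] : Submodule B (B ⊗[ℂ] N) :=
  Submodule.span B {t | ∃ (b : B) (a : A) (n : N), t = (b * φ a) ⊗ₜ[ℂ] n - b ⊗ₜ[ℂ] (a • n)}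

open scoped TensorProduct in
/-- The left `B`-module `B ⊗_A N`, for a homomorphism `φ : A → B` of `ℂ`-algebras and a left
`A`-module `N`. -/
abbrev InducedModule {A B : Type} [Ring A] [Algebra ℂ A] [Ring B] [Algebra ℂ B] (φ : A →ₐ[ℂ] B)
    (N : Type) [AddCommGroup N] [Module ℂ N] [Module A N] : Type :=
  (B ⊗[ℂ] N) ⧸ balancedRelations φ N

/-- The universal Whittaker module `M_ψ = U(𝒱) ⊗_{U(𝔫⁺)} ℂ_ψ`. -/
abbrev M (ψ : LieAlgebra.LieCharacter ℂ nPlus) : Type := InducedModule uPlusMap (CPsi ψ)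

open scoped TensorProduct in
/-- The vector `w = 1 ⊗ 1` of `M_ψ`. -/
noncomputable def w (ψ : LieAlgebra.LieCharacter ℂ nPlus) : M ψ :=
  Submodule.Quotient.mk ((1 : U) ⊗ₜ[ℂ] CPsi.one ψ)

/-- A vector `v` of a `𝒱`-module (that is, a `U(𝒱)`-module) is a Whittaker vector of type `ψ` if
`x v = ψ(x) v` for all `x ∈ 𝔫⁺`. -/
def IsWhittakerVector (ψ : LieAlgebra.LieCharacter ℂ nPlus) {W : Type} [AddCommGroup W]
    [Module ℂ W] [Module U W] [IsScalarTower ℂ U W] (v : W) : Prop :=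
  ∀ x : nPlus, UniversalEnvelopingAlgebra.ι ℂ (x : HV) • v = ψ x • v

section

attribute [local instance 100] LieRing.ofAssociativeRing

theorem ι_mem_center {c : HV} (hc : ∀ x : HV, ⁅c, x⁆ = 0) :
    UniversalEnvelopingAlgebra.ι ℂ c ∈ Subalgebra.center ℂ U := by
  let S : Subalgebra ℂ U := Subalgebra.centralizer ℂ {UniversalEnvelopingAlgebra.ι ℂ c}
  have hS : ∀ x : HV, UniversalEnvelopingAlgebra.ι ℂ x ∈ S := fun x => by
    have h := (UniversalEnvelopingAlgebra.ι ℂ).map_lie c x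
    rw [hc, map_zero, LieRing.of_associative_ring_bracket] at h
    rw [Subalgebra.mem_centralizer_iff]
    rintro _ rfl
    exact sub_eq_zero.mp h.symm
  let f : HV →ₗ⁅ℂ⁆ S :=
    { toFun := fun x => ⟨UniversalEnvelopingAlgebra.ι ℂ x, hS x⟩
      map_add' := fun x y => Subtype.ext (map_add _ x y)
      map_smul' := fun t x => Subtype.ext (map_smul _ t x)
      map_lie' := fun {x y} => Subtype.ext ((UniversalEnvelopingAlgebra.ι ℂ).map_lie x y) }
  have hid : S.val.comp (UniversalEnvelopingAlgebra.lift ℂ f) = AlgHom.id ℂ U := by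
    refine UniversalEnvelopingAlgebra.hom_ext ℂ (LieHom.ext fun x => ?_)
    exact congrArg Subtype.val (UniversalEnvelopingAlgebra.lift_ι_apply ℂ f x)
  rw [Subalgebra.mem_center_iff]
  intro u
  have hu : u ∈ S := by
    have h : ((UniversalEnvelopingAlgebra.lift ℂ f u : S) : U) = u := congrArg (fun g => g u) hid
    exact h ▸ (UniversalEnvelopingAlgebra.lift ℂ f u).2
  exact ((Subalgebra.mem_centralizer_iff ℂ).mp hu _ rfl).symm

end

/-- The central elements `z₀ = I 0`, `z₁`, `z₂`, `z₃` of `U(𝒱)`. -/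
noncomputable def zCentral : Fin 4 → Subalgebra.center ℂ U :=
  Fin.cons ⟨UniversalEnvelopingAlgebra.ι ℂ (I 0), ι_mem_center lie_I_zero⟩
    fun i => ⟨UniversalEnvelopingAlgebra.ι ℂ (z i), ι_mem_center (lie_z i)⟩

/-- The value `p(z) ∈ Z(𝒱) ⊆ U(𝒱)` of a polynomial `p` in four variables at
`z = (z₀, z₁, z₂, z₃)`. -/
noncomputable def evalZ (p : MvPolynomial (Fin 4) ℂ) : U :=
  ((MvPolynomial.aeval zCentral p : Subalgebra.center ℂ U) : U)

end HV

set_option linter.unusedSectionVars false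

open MvPolynomial

/-! The Whittaker condition is tested on free-field modules, one for each generic central character.

Straightening shows that `M ψ` is spanned over ℂ[z] by ordered monomials in `lowering a` applied to
`w` (`ofCoeffs_surjective`). Only this spanning half of a PBW statement is needed.

Two free bosons carry Feigin–Fuchs operators (`vir`, `vir_comm`), and the modes of boson 0 realise
the `I n`. Shifting the first mode of each boson by β_c turns the vacuum into a Whittaker vector
(`opL`, `opI`, `rep`). If ξ₃ and ψ(I₁)² + 2ψ(L₂)ξ₃ are nonzero, the parameters can be chosen to give
type ψ, central character ξ and β₁ ≠ 0 (`exists_parameters`), so `exists_intertwiner` maps `M ψ` to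
this Fock space.

Two facts on the Fock space, graded by weight, finish the argument. A Whittaker vector has no
component of positive weight (`component_eq_zero_of_whittaker`): the shift makes L_{n+1} contain -∑
β_c J_c(n), so on the top component every annihilation operator must vanish. Moreover, the shifted
lowering operators act to leading order as multiplication by algebraically independent linear forms
(`component_vacMon`, `aeval_leading_injective`), so a combination of monomials without positive
components involves only the empty one (`coeff_eq_zero_of_component`). Hence every other coefficient
polynomial of a Whittaker vector vanishes at all generic ξ, and so is zero. -/

namespace Fock

/-! ### Heisenberg operators and normally ordered quadratic expressions -/

variable {κ : Type}

/-- The Fock space of `κ` free bosons: the variable `(c, i)` is the creation operator of color `c`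
and mode `-(i + 1)`. -/
abbrev Space (κ : Type) : Type := MvPolynomial (κ × ℕ) ℂ

/-- The Heisenberg operators on the Fock space, with zero modes `h`. -/
noncomputable def J (h : κ → ℂ) (c : κ) : ℤ → Module.End ℂ (Space κ)
  | .ofNat 0 => h c • 1
  | .ofNat (i + 1) => ((i : ℂ) + 1) • (pderiv (c, i)).toLinearMap
  | .negSucc i => LinearMap.mulLeft ℂ (X (c, i))

theorem J_zero (h : κ → ℂ) (c : κ) (f : Space κ) : J h c 0 f = h c • f := rfl

theorem J_pos (h : κ → ℂ) (c : κ) (i : ℕ) (f : Space κ) :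
    J h c (i + 1 : ℤ) f = ((i : ℂ) + 1) • pderiv (c, i) f := rfl

theorem J_neg (h : κ → ℂ) (c : κ) (i : ℕ) (f : Space κ) :
    J h c (-(i + 1 : ℤ)) f = X (c, i) * f := by
  rw [show (-(i + 1 : ℤ)) = Int.negSucc i by rw [Int.negSucc_eq]]
  rfl

theorem int_trichotomy {p : ℤ → Prop} (zero : p 0) (pos : ∀ i : ℕ, p (i + 1))
    (neg : ∀ i : ℕ, p (-(i + 1))) (k : ℤ) : p k := by
  rcases lt_trichotomy k 0 with hk | rfl | hk
  · obtain ⟨i, rfl⟩ : ∃ i : ℕ, k = -(i + 1) := ⟨(-k - 1).toNat, by omega⟩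
    exact neg i
  · exact zero
  · obtain ⟨i, rfl⟩ : ∃ i : ℕ, k = i + 1 := ⟨(k - 1).toNat, by omega⟩
    exact pos i

theorem eq_C_of_pderiv_eq_zero {f : Space κ} (hf : ∀ a, pderiv a f = 0) :
    f = C (coeff 0 f) := by
  classical
  ext m
  rw [coeff_C]
  split_ifs with hm
  · rw [hm]
  · obtain ⟨a, ha⟩ : ∃ a, m a ≠ 0 := by
      by_contra! hcon
      exact hm (Finsupp.ext fun a => (hcon a).symm)
    have h1 := congrArg (coeff (m - Finsupp.single a 1)) (hf a)
    rw [coeff_pderiv, coeff_zero, mul_eq_zero] at h1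
    have h2 : m - Finsupp.single a 1 + Finsupp.single a 1 = m :=
      tsub_add_cancel_of_le (by
        rw [Finsupp.single_le_iff]; omega)
    rw [h2] at h1
    refine h1.resolve_right ?_
    exact Nat.cast_add_one_ne_zero _

/-- The commutator of two derivations is a derivation, and this one kills every variable. -/
theorem pderiv_comm (a b : κ × ℕ) (f : Space κ) :
    pderiv a (pderiv b f) = pderiv b (pderiv a f) := by
  classical
  have h : ⁅(pderiv a : Derivation ℂ (Space κ) (Space κ)),
      (pderiv b : Derivation ℂ (Space κ) (Space κ))⁆ = 0 := by
    refine MvPolynomial.derivation_ext fun i => ?_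
    rw [Derivation.commutator_apply, pderiv_X, pderiv_X]
    simp [Pi.single_apply, apply_ite (pderiv a), apply_ite (pderiv b)]
  have := DFunLike.congr_fun h f
  rw [Derivation.commutator_apply] at this
  exact sub_eq_zero.mp this

/-- The normally ordered product of two modes of the same color. -/
noncomputable def normalProd (h : κ → ℂ) (c : κ) (k m : ℤ) : Module.End ℂ (Space κ) :=
  if k ≤ m then J h c k * J h c m else J h c m * J h c k

theorem normalProd_of_le (h : κ → ℂ) (c : κ) {k m : ℤ} (hkm : k ≤ m) (f : Space κ) :
    normalProd h c k m f = J h c k (J h c m f) := by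
  rw [normalProd, if_pos hkm]; rfl

theorem normalProd_symm (h : κ → ℂ) (c : κ) (k m : ℤ) :
    normalProd h c k m = normalProd h c m k := by
  unfold normalProd
  split_ifs with h1 h2
  · rw [le_antisymm h1 h2]
  · rfl
  · rfl
  · omega

theorem normalProd_of_ge (h : κ → ℂ) (c : κ) {k m : ℤ} (hkm : m ≤ k) (f : Space κ) :
    normalProd h c k m f = J h c m (J h c k f) := by
  rw [normalProd_symm, normalProd_of_le h c hkm]

theorem exists_J_eq_zero (h : κ → ℂ) (f : Space κ) :
    ∃ N : ℤ, 0 ≤ N ∧ ∀ c k, N < k → J h c k f = 0 := by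
  refine ⟨(f.vars.sup fun a => a.2) + 1, by positivity, fun c k hk => ?_⟩
  obtain ⟨i, rfl⟩ : ∃ i : ℕ, k = i + 1 := ⟨(k - 1).toNat, by omega⟩
  rw [J_pos, pderiv_eq_zero_of_notMem_vars, smul_zero]
  intro hi
  have := Finset.le_sup (f := fun a : κ × ℕ => a.2) hi
  simp only at this
  omega

/-- Normal ordering applies the larger mode first, so a nonzero term needs both i and n - i to be at
most N. This makes the infinite sum in `quad` finite on each polynomial. -/
theorem normalProd_support (h : κ → ℂ) (c : κ) (n : ℤ) {f : Space κ} {N : ℤ}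
    (hN : ∀ c k, N < k → J h c k f = 0) :
    Function.support (fun i : ℤ => normalProd h c i (n - i) f) ⊆ Finset.Icc (n - N) N := by
  intro i hi
  rw [Function.mem_support] at hi
  rw [Finset.coe_Icc, Set.mem_Icc]
  by_contra hcon
  refine hi ?_
  rcases le_total i (n - i) with h1 | h1
  · rw [normalProd_of_le h c h1, hN c (n - i) (by omega), map_zero]
  · rw [normalProd_of_ge h c h1, hN c i (by omega), map_zero]

theorem hasFiniteSupport_normalProd (h : κ → ℂ) (c : κ) (n : ℤ) (f : Space κ) :
    (fun i : ℤ => normalProd h c i (n - i) f).HasFiniteSupport := by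
  obtain ⟨N, -, hN⟩ := exists_J_eq_zero h f
  exact (Finset.finite_toSet _).subset (normalProd_support h c n hN)

variable [DecidableEq κ]

theorem pderiv_X_mul (a b : κ × ℕ) (f : Space κ) :
    pderiv a (X b * f) = X b * pderiv a f + (if a = b then (1 : ℂ) else 0) • f := by
  rw [pderiv_mul, pderiv_X]
  by_cases hab : a = b
  · subst hab; simp [add_comm]
  · have : b ≠ a := fun h => hab h.symm
    simp [hab]

theorem J_comm (h : κ → ℂ) (c c' : κ) (k m : ℤ) (f : Space κ) :
    J h c k (J h c' m f) =
      J h c' m (J h c k f) + (if c = c' ∧ k + m = 0 then (k : ℂ) else 0) • f := by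
  induction k using int_trichotomy with
  | zero => simp [J_zero]
  | pos i =>
    induction m using int_trichotomy with
    | zero => simp only [J_zero, map_smul]; rw [if_neg (fun h => absurd h.2 (by omega))]; simp
    | pos j =>
      simp only [J_pos, map_smul]
      rw [if_neg (fun h => absurd h.2 (by omega)), zero_smul, add_zero, pderiv_comm, smul_comm]
    | neg j =>
      simp only [J_pos, J_neg, pderiv_X_mul, smul_add, mul_smul_comm, Prod.mk.injEq]
      by_cases hc : c = c' ∧ i = j
      · rw [if_pos hc, if_pos ⟨hc.1, by omega⟩, one_smul]; push_cast; rfl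
      · rw [if_neg hc, if_neg (fun h => hc ⟨h.1, by omega⟩)]; simp
  | neg i =>
    induction m using int_trichotomy with
    | zero => simp only [J_zero, map_smul]; rw [if_neg (fun h => absurd h.2 (by omega))]; simp
    | pos j =>
      simp only [J_pos, J_neg, pderiv_X_mul, smul_add, mul_smul_comm, Prod.mk.injEq]
      by_cases hc : c = c' ∧ i = j
      · obtain ⟨rfl, rfl⟩ := hc
        rw [if_pos ⟨rfl, rfl⟩, if_pos (by simp), one_smul]; push_cast
        module
      · rw [if_neg (by rintro ⟨h, h'⟩; exact hc ⟨h.symm, h'.symm⟩),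
          if_neg (fun h => hc ⟨h.1, by omega⟩)]; simp
    | neg j =>
      simp only [J_neg]
      rw [if_neg (fun h => absurd h.2 (by omega)), zero_smul, add_zero, mul_left_comm]

/-- The sum of all normally ordered products of two modes of color `c` of total mode `n`. -/
noncomputable def quad (h : κ → ℂ) (c : κ) (n : ℤ) : Module.End ℂ (Space κ) where
  toFun f := ∑ᶠ i : ℤ, normalProd h c i (n - i) f
  map_add' f g := by
    simp only [map_add]
    exact finsum_add_distrib (hasFiniteSupport_normalProd h c n f)
      (hasFiniteSupport_normalProd h c n g)
  map_smul' t f := by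
    simp only [map_smul, RingHom.id_apply]
    exact (smul_finsum t _).symm

theorem quad_apply (h : κ → ℂ) (c : κ) (n : ℤ) (f : Space κ) :
    quad h c n f = ∑ᶠ i : ℤ, normalProd h c i (n - i) f := rfl

theorem normalProd_J (h : κ → ℂ) (c c' : κ) (i j k : ℤ) (f : Space κ) :
    normalProd h c i j (J h c' k f) = J h c' k (normalProd h c i j f)
      + ((if c = c' ∧ j + k = 0 then (j : ℂ) else 0) • J h c i f
        + (if c = c' ∧ i + k = 0 then (i : ℂ) else 0) • J h c j f) := by
  rcases le_total i j with hij | hij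
  · simp only [normalProd_of_le h c hij, J_comm h c c' _ k, map_add, map_smul]
    module
  · simp only [normalProd_of_ge h c hij, J_comm h c c' _ k, map_add, map_smul]
    module

/-- Commuting J(k) past either factor of a product leaves a Kronecker delta, so each factor
contributes one surviving index and -k J(n + k). -/
theorem quad_J (h : κ → ℂ) (c c' : κ) (n k : ℤ) (f : Space κ) :
    quad h c n (J h c' k f) = J h c' k (quad h c n f)
      + (if c = c' then -(2 * k : ℂ) else 0) • J h c (n + k) f := by
  have h1 : ∑ᶠ i : ℤ, (if c = c' ∧ n - i + k = 0 then ((n - i : ℤ) : ℂ) else 0) • J h c i f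
      = (if c = c' then -(k : ℂ) else 0) • J h c (n + k) f := by
    rw [finsum_eq_single _ (n + k)]
    · by_cases hc : c = c'
      · rw [if_pos ⟨hc, by ring⟩, if_pos hc]; push_cast; module
      · simp [hc]
    · intro i hi
      rw [if_neg (fun h => absurd h.2 (by omega)), zero_smul]
  have h2 : ∑ᶠ i : ℤ, (if c = c' ∧ i + k = 0 then (i : ℂ) else 0) • J h c (n - i) f
      = (if c = c' then -(k : ℂ) else 0) • J h c (n + k) f := by
    rw [finsum_eq_single _ (-k)]
    · by_cases hc : c = c'
      · rw [if_pos ⟨hc, by ring⟩, if_pos hc]; push_cast; simp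
      · simp [hc]
    · intro i hi
      rw [if_neg (fun h => absurd h.2 (by omega)), zero_smul]
  have f1 : (fun i : ℤ => (if c = c' ∧ n - i + k = 0 then ((n - i : ℤ) : ℂ) else 0) • J h c i f
      ).HasFiniteSupport := by
    refine (Set.finite_singleton (n + k)).subset fun i hi => ?_
    by_contra hcon
    rw [Set.mem_singleton_iff] at hcon
    exact hi (by simp only; rw [if_neg (fun h => absurd h.2 (by omega)), zero_smul])
  have f2 : (fun i : ℤ => (if c = c' ∧ i + k = 0 then (i : ℂ) else 0) • J h c (n - i) f
      ).HasFiniteSupport := by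
    refine (Set.finite_singleton (-k)).subset fun i hi => ?_
    by_contra hcon
    rw [Set.mem_singleton_iff] at hcon
    exact hi (by simp only; rw [if_neg (fun h => absurd h.2 (by omega)), zero_smul])
  have f3 := hasFiniteSupport_normalProd h c n f
  have f4 : (fun i : ℤ => J h c' k (normalProd h c i (n - i) f)).HasFiniteSupport :=
    f3.subset fun i hi hi' => hi (by simp only at hi' ⊢; rw [hi', map_zero])
  rw [quad_apply, quad_apply]
  simp only [normalProd_J]
  rw [finsum_add_distrib f4 ((Set.Finite.union f1 f2).subset (Function.support_add _ _)),
    finsum_add_distrib f1 f2, h1, h2]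
  have h3 := (J h c' k).toAddMonoidHom.map_finsum f3
  simp only [LinearMap.toAddMonoidHom_coe] at h3
  rw [h3]
  split_ifs
  · module
  · simp

/-! ### Feigin–Fuchs operators and their commutators with the Heisenberg modes -/

variable [Fintype κ]

/-- The Feigin–Fuchs Virasoro operators, with background charges `g`. -/
noncomputable def vir (h g : κ → ℂ) (n : ℤ) : Module.End ℂ (Space κ) :=
  (-(1 / 2) : ℂ) • ∑ c, quad h c n + ((n : ℂ) - 1) • ∑ c, g c • J h c n

theorem vir_apply (h g : κ → ℂ) (n : ℤ) (f : Space κ) :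
    vir h g n f = (-(1 / 2) : ℂ) • ∑ c, quad h c n f + ((n : ℂ) - 1) • ∑ c, g c • J h c n f := by
  simp [vir]

/-- The factor -1/2 turns the -2k of `quad_J` into k, and the coefficient n - 1 of the linear term
produces exactly the cocycle n² - n of [L, I]. -/
theorem vir_J (h g : κ → ℂ) (c : κ) (n k : ℤ) (f : Space κ) :
    vir h g n (J h c k f) = J h c k (vir h g n f) + (k : ℂ) • J h c (n + k) f
      + (if n + k = 0 then ((n : ℂ) - 1) * n * g c else 0) • f := by
  have h1 : ∑ c', quad h c' n (J h c k f) = J h c k (∑ c', quad h c' n f)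
      + (-(2 * k : ℂ)) • J h c (n + k) f := by
    simp only [quad_J, Finset.sum_add_distrib, map_sum]
    congr 1
    rw [Finset.sum_eq_single c (fun b _ hb => by rw [if_neg hb, zero_smul])
      (fun hc => absurd (Finset.mem_univ c) hc), if_pos rfl]
  have h2 : ∑ c', g c' • J h c' n (J h c k f) = J h c k (∑ c', g c' • J h c' n f)
      + (if n + k = 0 then (n : ℂ) * g c else 0) • f := by
    simp only [J_comm h _ c, smul_add, Finset.sum_add_distrib, map_sum, map_smul]
    congr 1
    rw [Finset.sum_eq_single c (fun b _ hb => by rw [if_neg (fun h => hb h.1), zero_smul, smul_zero])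
      (fun hc => absurd (Finset.mem_univ c) hc)]
    by_cases hn : n + k = 0
    · rw [if_pos ⟨rfl, hn⟩, if_pos hn, smul_smul, mul_comm]
    · rw [if_neg (fun h => hn h.2), if_neg hn]; simp
  rw [vir_apply, vir_apply, h1, h2, map_add, map_smul, map_smul]
  split_ifs <;> module

/-- An operator that commutes with all Heisenberg operators is a scalar. -/
theorem eq_smul_of_commute_J (h : κ → ℂ) {T : Module.End ℂ (Space κ)}
    (hT : ∀ c k f, T (J h c k f) = J h c k (T f)) (f : Space κ) :
    T f = coeff 0 (T 1) • f := by
  have hX : ∀ a f, T (X a * f) = X a * T f := fun a f => by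
    simpa only [J_neg] using hT a.1 (-(a.2 + 1 : ℤ)) f
  -- T commutes with annihilation, so T 1 is killed by all derivatives; creation operators then
  -- carry the scalar from 1 to all polynomials.
  have h1 : T 1 = C (coeff 0 (T 1)) := by
    refine eq_C_of_pderiv_eq_zero fun a => ?_
    have h2 := hT a.1 (a.2 + 1 : ℤ) 1
    simp only [J_pos, map_smul, pderiv_one, map_zero] at h2
    have h3 : ((a.2 : ℂ) + 1) ≠ 0 := by exact Nat.cast_add_one_ne_zero _
    exact (smul_eq_zero.mp (h2.symm.trans (smul_zero _))).resolve_left h3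
  induction f using MvPolynomial.induction_on with
  | C t => rw [C_eq_smul_one, map_smul, smul_comm]; congr 1; rw [h1]; simp [C_eq_smul_one]
  | add p q hp hq => rw [map_add, hp, hq, smul_add]
  | mul_X p a hp => rw [mul_comm, hX, hp, mul_smul_comm]

end Fock

/-! ### The weight grading and the Virasoro relations -/

namespace Fock

variable {κ : Type}

/-- The weight of the variables of the Fock space: minus the mode. -/
def wt (κ : Type) (a : κ × ℕ) : ℤ := a.2 + 1

theorem isWeightedHomogeneous_J (h : κ → ℂ) (c : κ) (k : ℤ) {f : Space κ} {d : ℤ}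
    (hf : IsWeightedHomogeneous (wt κ) f d) :
    IsWeightedHomogeneous (wt κ) (J h c k f) (d - k) := by
  induction k using int_trichotomy with
  | zero =>
    rw [J_zero, sub_zero]
    exact (weightedHomogeneousSubmodule ℂ (wt κ) d).smul_mem _ hf
  | pos i =>
    rw [J_pos]
    refine (weightedHomogeneousSubmodule ℂ (wt κ) _).smul_mem _ ?_
    exact hf.pderiv (by simp [wt])
  | neg i =>
    rw [J_neg, sub_neg_eq_add, add_comm]
    exact (isWeightedHomogeneous_X ℂ (wt κ) (c, i)).mul hf

theorem isWeightedHomogeneous_normalProd (h : κ → ℂ) (c : κ) (k m : ℤ) {f : Space κ} {d : ℤ}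
    (hf : IsWeightedHomogeneous (wt κ) f d) :
    IsWeightedHomogeneous (wt κ) (normalProd h c k m f) (d - (k + m)) := by
  rcases le_total k m with hkm | hkm
  · rw [normalProd_of_le h c hkm, show d - (k + m) = d - m - k by ring]
    exact isWeightedHomogeneous_J h c k (isWeightedHomogeneous_J h c m hf)
  · rw [normalProd_of_ge h c hkm, show d - (k + m) = d - k - m by ring]
    exact isWeightedHomogeneous_J h c m (isWeightedHomogeneous_J h c k hf)

variable [DecidableEq κ]

theorem isWeightedHomogeneous_quad (h : κ → ℂ) (c : κ) (n : ℤ) {f : Space κ} {d : ℤ}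
    (hf : IsWeightedHomogeneous (wt κ) f d) :
    IsWeightedHomogeneous (wt κ) (quad h c n f) (d - n) := by
  rw [quad_apply]
  refine finsum_induction (fun p => IsWeightedHomogeneous (wt κ) p (d - n))
    (isWeightedHomogeneous_zero ℂ _ _) (fun _ _ hp hq => hp.add hq) fun i => ?_
  simpa using isWeightedHomogeneous_normalProd h c i (n - i) hf

variable [Fintype κ]

theorem isWeightedHomogeneous_vir (h g : κ → ℂ) (n : ℤ) {f : Space κ} {d : ℤ}
    (hf : IsWeightedHomogeneous (wt κ) f d) :
    IsWeightedHomogeneous (wt κ) (vir h g n f) (d - n) := by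
  rw [vir_apply]
  let S := weightedHomogeneousSubmodule ℂ (wt κ) (d - n)
  exact S.add_mem
    (S.smul_mem _ (S.sum_mem fun c _ => isWeightedHomogeneous_quad h c n hf))
    (S.smul_mem _ (S.sum_mem fun c _ => S.smul_mem _ (isWeightedHomogeneous_J h c n hf)))

/-- The failure of `vir` to represent the Witt algebra. -/
noncomputable def anomaly (h g : κ → ℂ) (n m : ℤ) : Module.End ℂ (Space κ) :=
  vir h g n * vir h g m - vir h g m * vir h g n - ((m : ℂ) - n) • vir h g (n + m)

theorem anomaly_apply (h g : κ → ℂ) (n m : ℤ) (f : Space κ) :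
    anomaly h g n m f = vir h g n (vir h g m f) - vir h g m (vir h g n f)
      - ((m : ℂ) - n) • vir h g (n + m) f := rfl

/-- The Witt relation already holds on commutators with the modes J, so the anomaly commutes with
all of them. It remains only to find one scalar on the vacuum. -/
theorem anomaly_eq_smul (h g : κ → ℂ) (n m : ℤ) (f : Space κ) :
    anomaly h g n m f = coeff 0 (anomaly h g n m 1) • f := by
  refine eq_smul_of_commute_J h (fun c k f => ?_) f
  simp only [anomaly_apply, vir_J, map_add, map_sub, map_smul, smul_add]
  rw [show n + (m + k) = n + m + k by ring, show m + (n + k) = n + m + k by ring]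
  -- The inhomogeneous terms present for n + m + k = 0 cancel by the cocycle identity for n² - n.
  by_cases hk : n + m + k = 0
  · obtain rfl : k = -n - m := by omega
    simp only [show n + (-n - m) = -m by ring, show m + (-n - m) = -n by ring]
    split_ifs <;> (push_cast; module)
  · simp only [if_neg hk]
    split_ifs <;> (push_cast; module)

theorem J_pos_one (h : κ → ℂ) (c : κ) {k : ℤ} (hk : 0 < k) : J h c k 1 = 0 := by
  obtain ⟨i, rfl⟩ : ∃ i : ℕ, k = i + 1 := ⟨(k - 1).toNat, by omega⟩
  rw [J_pos, pderiv_one, smul_zero]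

theorem coeff_zero_J_neg (h : κ → ℂ) (c : κ) {k : ℤ} (hk : k < 0) (f : Space κ) :
    coeff 0 (J h c k f) = 0 := by
  obtain ⟨i, rfl⟩ : ∃ i : ℕ, k = -(i + 1) := ⟨(-k - 1).toNat, by omega⟩
  rw [J_neg]
  change constantCoeff (X (c, i) * f) = 0
  simp

theorem normalProd_one_of_pos (h : κ → ℂ) (c : κ) {k m : ℤ} (hkm : 0 < k ∨ 0 < m) :
    normalProd h c k m 1 = 0 := by
  rcases le_total k m with hle | hle
  · rw [normalProd_of_le h c hle, J_pos_one h c (by omega), map_zero]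
  · rw [normalProd_of_ge h c hle, J_pos_one h c (by omega), map_zero]

theorem vir_pos_one (h g : κ → ℂ) {n : ℤ} (hn : 0 < n) : vir h g n 1 = 0 := by
  have hq : ∀ c, quad h c n 1 = 0 := fun c => by
    rw [quad_apply]
    exact finsum_eq_zero_of_forall_eq_zero fun i => normalProd_one_of_pos h c (by omega)
  simp [vir_apply, hq, J_pos_one h _ hn]

theorem vir_zero_one (h g : κ → ℂ) :
    vir h g 0 1 = (-∑ c, (h c ^ 2 / 2 + g c * h c)) • (1 : Space κ) := by
  have hq : ∀ c, quad h c 0 1 = (h c ^ 2) • (1 : Space κ) := fun c => by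
    rw [quad_apply, finsum_eq_single _ 0]
    · rw [sub_zero, normalProd_of_le h c le_rfl, J_zero, J_zero, smul_smul, sq]
    · intro i hi
      exact normalProd_one_of_pos h c (by omega)
  simp only [vir_apply, hq, J_zero, smul_smul, ← Finset.sum_smul, ← add_smul, Finset.sum_add_distrib,
    ← Finset.sum_div]
  congr 1
  push_cast
  ring

theorem sum_range_mul_sub (p : ℕ) :
    ∑ a ∈ Finset.range (p + 1), (a : ℂ) * ((p : ℂ) - a) = ((p : ℂ) ^ 3 - p) / 6 := by
  have h : ∀ (q : ℕ) (t : ℂ), ∑ a ∈ Finset.range (q + 1), (a : ℂ) * (t - a)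
      = t * (q * (q + 1)) / 2 - q * (q + 1) * (2 * q + 1) / 6 := fun q t => by
    induction q with
    | zero => simp
    | succ q ih => rw [Finset.sum_range_succ, ih]; push_cast; ring
  rw [h]; ring

theorem coeff_J_J_one (h : κ → ℂ) (c : κ) {k : ℤ} (hk : 0 ≤ k) :
    coeff 0 (J h c k (J h c (-k) 1)) = (k : ℂ) + if k = 0 then h c ^ 2 else 0 := by
  rw [J_comm]
  rcases hk.eq_or_lt with rfl | hk
  · simp [J_zero]; ring
  · rw [J_pos_one h c hk, map_zero, if_pos ⟨rfl, by ring⟩, if_neg hk.ne']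
    simp

/-- A creation operator on the left has no constant term, so only the commutator survives. -/
theorem coeff_vir_J_neg (h g : κ → ℂ) (c : κ) {k : ℤ} (hk : k < 0) (n : ℤ) (f : Space κ) :
    coeff 0 (vir h g n (J h c k f)) = k * coeff 0 (J h c (n + k) f)
      + (if n + k = 0 then ((n : ℂ) - 1) * n * g c else 0) * coeff 0 f := by
  rw [vir_J, coeff_add, coeff_add, coeff_zero_J_neg h c hk, zero_add, coeff_smul, coeff_smul,
    smul_eq_mul, smul_eq_mul]

theorem coeff_vir_normalProd (h g : κ → ℂ) (c : κ) {k m : ℤ} (hk : k ≤ 0) (hm : m ≤ 0)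
    (hkm : k + m < 0) :
    coeff 0 (vir h g (-(k + m)) (normalProd h c k m 1)) = -(k * m : ℂ)
      + if k = 0 ∨ m = 0 then ((k : ℂ) + m) * h c ^ 2 + (k + m) * (k + m + 1) * g c * h c
        else 0 := by
  wlog hle : k ≤ m generalizing k m
  · have := this hm hk (by omega) (by omega)
    rw [normalProd_symm, add_comm k m, this]
    simp only [or_comm (a := k = 0)]
    split_ifs <;> ring
  rw [normalProd_of_le h c hle, coeff_vir_J_neg h g c (by omega),
    show -(k + m) + k = -m by ring]
  have := coeff_J_J_one h c (k := -m) (by omega)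
  rw [neg_neg] at this
  rw [this]
  rcases hm.eq_or_lt with rfl | hm
  · simp [J_zero]; ring
  · rw [if_neg (by omega), if_neg (by omega), if_neg (by omega)]
    push_cast; ring

theorem coeff_vir_vir_neg_one (h g : κ → ℂ) (p : ℕ) (hp : 0 < p) :
    coeff 0 (vir h g p (vir h g (-p) 1)) =
      ∑ c, (((p : ℂ) ^ 3 - p) * (1 / 12 - g c ^ 2) + p * h c ^ 2 + 2 * p * g c * h c) := by
  -- A positive mode kills the vacuum, so only pairs of nonpositive modes (-a, -(p - a)) with 0 ≤ a
  -- ≤ p remain.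
  have hq : ∀ c, quad h c (-p) 1
      = ∑ a ∈ Finset.range (p + 1), normalProd h c (-(a : ℤ)) (-((p : ℤ) - a)) 1 := fun c => by
    have hinj : Set.InjOn (fun a : ℕ => -(a : ℤ)) (Finset.range (p + 1)) :=
      fun a _ b _ hab => by simpa using hab
    rw [quad_apply, finsum_eq_sum_of_support_subset (s := (Finset.range (p + 1)).image
      fun a : ℕ => -(a : ℤ)), Finset.sum_image hinj]
    · refine Finset.sum_congr rfl fun a _ => ?_
      congr 2; ring
    · intro i hi
      rw [Function.mem_support] at hi
      rw [Finset.coe_image, Set.mem_image]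
      by_cases hi' : 0 < i ∨ 0 < -(p : ℤ) - i
      · exact absurd (normalProd_one_of_pos h c hi') hi
      · refine ⟨(-i).toNat, ?_, by omega⟩
        rw [Finset.mem_coe, Finset.mem_range]; omega
  have hs : ∀ c, coeff 0 (vir h g p (quad h c (-p) 1))
      = -((p : ℂ) ^ 3 - p) / 6 + 2 * (-(p : ℂ) * h c ^ 2 + p * (p - 1) * g c * h c) := fun c => by
    rw [hq, map_sum, coeff_sum]
    -- The bulk terms a(p - a) sum to (p³ - p)/6, the source of the central charge. Zero modes enter
    -- only at the ends a = 0 and a = p, which are distinct as p > 0.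
    have ht : ∀ a ∈ Finset.range (p + 1),
        coeff 0 (vir h g p (normalProd h c (-(a : ℤ)) (-((p : ℤ) - a)) 1))
        = -((a : ℂ) * (p - a)) + ((if a = 0 then (-(p : ℂ) * h c ^ 2 + p * (p - 1) * g c * h c) else 0)
          + if a = p then (-(p : ℂ) * h c ^ 2 + p * (p - 1) * g c * h c) else 0) := fun a ha => by
      rw [Finset.mem_range] at ha
      have := coeff_vir_normalProd h g c (k := -(a : ℤ)) (m := -((p : ℤ) - a)) (by omega)
        (by omega) (by omega)
      rw [show -(-(a : ℤ) + -((p : ℤ) - a)) = p by ring] at this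
      rw [this]
      push_cast
      split_ifs <;> first | (exfalso; omega) | ring
    rw [Finset.sum_congr rfl ht, Finset.sum_add_distrib, Finset.sum_neg_distrib, sum_range_mul_sub,
      Finset.sum_add_distrib, Finset.sum_ite_eq', Finset.sum_ite_eq', if_pos (by simp),
      if_pos (by simp)]
    ring
  have hl : ∀ c, coeff 0 (vir h g p (J h c (-p) 1)) = -(p : ℂ) * h c + (p - 1) * p * g c := fun c => by
    rw [coeff_vir_J_neg h g c (by omega), add_neg_cancel, J_zero]
    simp
  rw [vir_apply h g (-p), map_add, map_smul, map_smul, map_sum, map_sum, coeff_add, coeff_smul,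
    coeff_smul, coeff_sum, coeff_sum]
  simp only [map_smul, coeff_smul, hs, hl, smul_eq_mul, Finset.mul_sum, ← Finset.sum_add_distrib]
  refine Finset.sum_congr rfl fun c _ => ?_
  push_cast
  ring

theorem coeff_anomaly_one (h g : κ → ℂ) (n m : ℤ) :
    coeff 0 (anomaly h g n m 1) =
      if m = -n then ((n : ℂ) ^ 3 - n) / 12 * ∑ c, (1 - 12 * g c ^ 2) else 0 := by
  split_ifs with hm
  · subst hm
    have hpos : ∀ p : ℕ, 0 < p → coeff 0 (anomaly h g p (-p) 1)
        = ((p : ℂ) ^ 3 - p) / 12 * ∑ c, (1 - 12 * g c ^ 2) := fun p hp => by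
      rw [anomaly_apply, coeff_sub, coeff_sub, coeff_vir_vir_neg_one h g p hp,
        vir_pos_one h g (n := p) (by omega), map_zero, add_neg_cancel, vir_zero_one, coeff_zero,
        coeff_smul, coeff_smul, coeff_zero_one, smul_eq_mul, smul_eq_mul, mul_one, mul_neg,
        sub_zero, sub_neg_eq_add, Finset.mul_sum, Finset.mul_sum, ← Finset.sum_add_distrib]
      refine Finset.sum_congr rfl fun c _ => ?_
      push_cast
      ring
    rcases lt_trichotomy n 0 with hn | rfl | hn
    · obtain ⟨p, rfl⟩ : ∃ p : ℕ, n = -p := ⟨(-n).toNat, by omega⟩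
      -- Antisymmetry reduces negative n to positive n.
      have h1 : anomaly h g (-p) (-(-p)) 1 = -anomaly h g p (-p) 1 := by
        rw [neg_neg, anomaly_apply, anomaly_apply, neg_add_cancel, add_neg_cancel]
        push_cast
        module
      rw [h1, coeff_neg, hpos p (by omega)]
      push_cast
      ring
    · simp [anomaly_apply]
    · obtain ⟨p, rfl⟩ : ∃ p : ℕ, n = p := ⟨n.toNat, by omega⟩
      exact_mod_cast hpos p (by omega)
  · by_contra hne
    -- For n + m ≠ 0 the anomaly sends the vacuum to nonzero weight, where there is no constant
    -- term.
    have h1 : IsWeightedHomogeneous (wt κ) (1 : Space κ) 0 := isWeightedHomogeneous_one _ _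
    let S := weightedHomogeneousSubmodule ℂ (wt κ) (-(n + m))
    have h2 : anomaly h g n m 1 ∈ S := by
      rw [anomaly_apply]
      refine S.sub_mem (S.sub_mem ?_ ?_) (S.smul_mem _ ?_)
      · have := isWeightedHomogeneous_vir h g n (isWeightedHomogeneous_vir h g m h1)
        rwa [show 0 - m - n = -(n + m) by ring] at this
      · have := isWeightedHomogeneous_vir h g m (isWeightedHomogeneous_vir h g n h1)
        rwa [show 0 - n - m = -(n + m) by ring] at this
      · have := isWeightedHomogeneous_vir h g (n + m) h1
        rwa [show 0 - (n + m) = -(n + m) by ring] at this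
    have h3 := h2 hne
    rw [map_zero] at h3
    omega

theorem vir_comm (h g : κ → ℂ) (n m : ℤ) (f : Space κ) :
    vir h g n (vir h g m f) = vir h g m (vir h g n f) + ((m : ℂ) - n) • vir h g (n + m) f
      + (if m = -n then ((n : ℂ) ^ 3 - n) / 12 * ∑ c, (1 - 12 * g c ^ 2) else 0) • f := by
  rw [← coeff_anomaly_one, ← anomaly_eq_smul, anomaly_apply]
  abel

end Fock

/-! ### Shifted operators and the representation on the Fock space -/

namespace Fock

variable {κ : Type} [DecidableEq κ] [Fintype κ]

/-- The combination of the Heisenberg operators of all colors with coefficients `β`. -/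
noncomputable def combJ (h β : κ → ℂ) (k : ℤ) : Module.End ℂ (Space κ) := ∑ c, β c • J h c k

theorem combJ_apply (h β : κ → ℂ) (k : ℤ) (f : Space κ) :
    combJ h β k f = ∑ c, β c • J h c k f := by simp [combJ]

theorem combJ_J (h β : κ → ℂ) (c : κ) (k m : ℤ) (f : Space κ) :
    combJ h β k (J h c m f) = J h c m (combJ h β k f)
      + (if k + m = 0 then β c * k else 0) • f := by
  simp only [combJ_apply, J_comm h _ c k m, smul_add, Finset.sum_add_distrib, map_sum, map_smul]
  congr 1
  rw [Finset.sum_eq_single c (fun b _ hb => by rw [if_neg (fun h => hb h.1), zero_smul, smul_zero])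
    (fun hc => absurd (Finset.mem_univ c) hc), smul_smul]
  simp

theorem combJ_combJ (h β : κ → ℂ) (k m : ℤ) (f : Space κ) :
    combJ h β k (combJ h β m f) = combJ h β m (combJ h β k f)
      + (if k + m = 0 then k * ∑ c, β c ^ 2 else 0) • f := by
  rw [combJ_apply h β m, combJ_apply h β m]
  simp only [map_sum, map_smul, combJ_J, smul_add, Finset.sum_add_distrib, smul_smul]
  rw [← Finset.sum_smul]
  congr 2
  split_ifs
  · rw [Finset.mul_sum]; exact Finset.sum_congr rfl fun c _ => by ring
  · simp

theorem vir_combJ (h g β : κ → ℂ) (n k : ℤ) (f : Space κ) :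
    vir h g n (combJ h β k f) = combJ h β k (vir h g n f) + (k : ℂ) • combJ h β (n + k) f
      + (if n + k = 0 then ((n : ℂ) - 1) * n * ∑ c, β c * g c else 0) • f := by
  simp only [combJ_apply, map_sum, map_smul, vir_J, smul_add, Finset.sum_add_distrib, smul_smul,
    Finset.smul_sum]
  rw [← Finset.sum_smul]
  congr 2
  · exact congrArg _ (funext fun c => by rw [mul_comm])
  · split_ifs
    · rw [Finset.mul_sum]; exact Finset.sum_congr rfl fun c _ => by ring
    · simp

theorem isWeightedHomogeneous_combJ (h β : κ → ℂ) (k : ℤ) {f : Space κ} {d : ℤ}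
    (hf : IsWeightedHomogeneous (wt κ) f d) :
    IsWeightedHomogeneous (wt κ) (combJ h β k f) (d - k) := by
  rw [combJ_apply]
  let S := weightedHomogeneousSubmodule ℂ (wt κ) (d - k)
  exact S.sum_mem fun c _ => S.smul_mem _ (isWeightedHomogeneous_J h c k hf)

/-- The Virasoro operators after the shift by `β` of the first Heisenberg modes. -/
noncomputable def opL (h g β : κ → ℂ) (n : ℤ) : Module.End ℂ (Space κ) :=
  vir h g n - combJ h β (n - 1) - (if n = 2 then (∑ c, β c ^ 2) / 2 else 0) • 1

/-- The Heisenberg operators of color `c`, shifted by `β` and scaled by `s`. -/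
noncomputable def opI (h β : κ → ℂ) (c : κ) (s : ℂ) (n : ℤ) : Module.End ℂ (Space κ) :=
  s • (J h c n + (if n = 1 then β c else 0) • 1)

theorem opL_apply (h g β : κ → ℂ) (n : ℤ) (f : Space κ) :
    opL h g β n f = vir h g n f - combJ h β (n - 1) f
      - (if n = 2 then (∑ c, β c ^ 2) / 2 else 0) • f := rfl

theorem opI_apply (h β : κ → ℂ) (c : κ) (s : ℂ) (n : ℤ) (f : Space κ) :
    opI h β c s n f = s • (J h c n f + (if n = 1 then β c else 0) • f) := rfl

/-- Substituting J_c(1) + β_c for J_c(1) preserves the Heisenberg relations, and `opL` is what `vir`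
becomes. The background term is unaffected, because its factor n - 1 vanishes at n = 1; so the
central charge is unchanged. -/
theorem opL_opL (h g β : κ → ℂ) (n m : ℤ) (f : Space κ) :
    opL h g β n (opL h g β m f) = opL h g β m (opL h g β n f)
      + ((m : ℂ) - n) • opL h g β (n + m) f
      + (if m = -n then ((n : ℂ) ^ 3 - n) / 12 * ∑ c, (1 - 12 * g c ^ 2) else 0) • f := by
  simp only [opL_apply, map_sub, map_smul]
  rw [vir_comm h g n m, combJ_combJ h β (n - 1) (m - 1), vir_combJ h g β n, vir_combJ h g β m,
    show n + (m - 1) = n + m - 1 by ring, show m + (n - 1) = n + m - 1 by ring]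
  have h1 : (if n + m - 1 = 0 then ((n : ℂ) - 1) * n * ∑ c, β c * g c else 0)
      = if n + m - 1 = 0 then ((m : ℂ) - 1) * m * ∑ c, β c * g c else 0 := by
    split_ifs with hnm
    · obtain rfl : m = 1 - n := by omega
      push_cast; ring
    · rfl
  have h2 : (if n - 1 + (m - 1) = 0 then ((n - 1 : ℤ) : ℂ) * ∑ c, β c ^ 2 else 0)
      = -(((m : ℂ) - n) * if n + m = 2 then (∑ c, β c ^ 2) / 2 else 0) := by
    by_cases hnm : n + m = 2
    · obtain rfl : m = 2 - n := by omega
      rw [if_pos (by ring), if_pos (by ring)]; push_cast; ring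
    · rw [if_neg (by omega), if_neg hnm]; ring
  rw [h1, h2]
  push_cast
  module

theorem opL_opI (h g β : κ → ℂ) (c : κ) (s : ℂ) (n m : ℤ) (f : Space κ) :
    opL h g β n (opI h β c s m f) = opI h β c s m (opL h g β n f)
      + (m : ℂ) • opI h β c s (n + m) f
      + ((if m = -n then (n : ℂ) ^ 2 - n else 0) * (s * g c)) • f := by
  simp only [opL_apply, opI_apply, map_sub, map_add, map_smul]
  rw [vir_J, combJ_J]
  have h1 : (if n - 1 + m = 0 then β c * ((n - 1 : ℤ) : ℂ) else 0)
      = -((m : ℂ) * if n + m = 1 then β c else 0) := by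
    by_cases hnm : n + m = 1
    · obtain rfl : m = 1 - n := by omega
      rw [if_pos (by ring), if_pos (by ring)]; push_cast; ring
    · rw [if_neg (by omega), if_neg hnm]; ring
  have h2 : (if n + m = 0 then ((n : ℂ) - 1) * n * g c else 0)
      = (if m = -n then (n : ℂ) ^ 2 - n else 0) * g c := by
    by_cases hnm : n + m = 0
    · rw [if_pos hnm, if_pos (by omega)]; ring
    · rw [if_neg hnm, if_neg (by omega)]; ring
  rw [h1, h2]
  module

theorem opI_opI (h β : κ → ℂ) (c : κ) (s : ℂ) (n m : ℤ) (f : Space κ) :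
    opI h β c s n (opI h β c s m f) = opI h β c s m (opI h β c s n f)
      + ((if m = -n then (n : ℂ) else 0) * s ^ 2) • f := by
  simp only [opI_apply, map_add, map_smul]
  rw [J_comm h c c n m]
  have h1 : (if c = c ∧ n + m = 0 then (n : ℂ) else 0) = if m = -n then (n : ℂ) else 0 := by
    by_cases hnm : n + m = 0
    · rw [if_pos ⟨rfl, hnm⟩, if_pos (by omega)]
    · rw [if_neg (fun h => hnm h.2), if_neg (by omega)]
  rw [h1]
  module

/-- The operators by which the basis vectors of the twisted Heisenberg–Virasoro algebra act on
the Fock space. -/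
noncomputable def basisOp (h g β : κ → ℂ) (c : κ) (s : ℂ) : HVIndex → Module.End ℂ (Space κ)
  | .L n => opL h g β n
  | .I n => opI h β c s n
  | .z i => (![∑ c, (1 - 12 * g c ^ 2), s * g c, s ^ 2] i) • 1

/-- The linear map by which the twisted Heisenberg–Virasoro algebra acts on the Fock space. -/
noncomputable def repMap (h g β : κ → ℂ) (c : κ) (s : ℂ) : HV →ₗ[ℂ] Module.End ℂ (Space κ) :=
  Finsupp.linearCombination ℂ (basisOp h g β c s)

theorem repMap_e (h g β : κ → ℂ) (c : κ) (s : ℂ) (i : HVIndex) :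
    repMap h g β c s (HV.e i) = basisOp h g β c s i :=
  (Finsupp.linearCombination_single ℂ (1 : ℂ) i).trans (one_smul _ _)

theorem repMap_basisBracket (h g β : κ → ℂ) (c : κ) (s : ℂ) (i j : HVIndex) (f : Space κ) :
    repMap h g β c s (HV.basisBracket i j) f =
      basisOp h g β c s i (basisOp h g β c s j f)
        - basisOp h g β c s j (basisOp h g β c s i f) := by
  rcases i with n | n | a <;> rcases j with m | m | b <;>
    simp only [HV.basisBracket, HV.L, HV.I, HV.z, map_add, map_neg, map_smul, map_zero, repMap_e,
      basisOp, LinearMap.add_apply, LinearMap.neg_apply, LinearMap.smul_apply,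
      LinearMap.zero_apply, Module.End.one_apply, sub_self, Matrix.cons_val]
  · rw [opL_opL]; split_ifs <;> module
  · rw [opL_opI]; split_ifs <;> module
  · rw [opL_opI h g β c s m n]; split_ifs <;> module
  · rw [opI_opI]; split_ifs <;> module
  · rw [smul_comm, sub_self]

attribute [local instance 100] LieRing.ofAssociativeRing

/-- The representation of the twisted Heisenberg–Virasoro algebra on the Fock space. -/
noncomputable def rep (h g β : κ → ℂ) (c : κ) (s : ℂ) :
    HV →ₗ⁅ℂ⁆ Module.End ℂ (Space κ) :=
  { repMap h g β c s with
    map_lie' := fun {x y} => by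
      change repMap h g β c s ⁅x, y⁆ = ⁅repMap h g β c s x, repMap h g β c s y⁆
      induction x using HV.induction_e with
      | zero => simp
      | add x x' hx hx' => rw [add_lie, map_add, hx, hx', map_add, add_lie]
      | smul r i =>
      induction y using HV.induction_e with
      | zero => simp
      | add y y' hy hy' => rw [lie_add, map_add, hy, hy', map_add, lie_add]
      | smul t j =>
      rw [smul_lie, lie_smul, HV.lie_e]
      refine LinearMap.ext fun f => ?_
      rw [LieRing.of_associative_ring_bracket]
      simp only [map_smul, repMap_e, LinearMap.smul_apply, repMap_basisBracket, LinearMap.sub_apply,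
        Module.End.mul_apply]
      module }

theorem rep_L (h g β : κ → ℂ) (c : κ) (s : ℂ) (n : ℤ) :
    rep h g β c s (HV.L n) = opL h g β n := repMap_e h g β c s _

theorem rep_I (h g β : κ → ℂ) (c : κ) (s : ℂ) (n : ℤ) :
    rep h g β c s (HV.I n) = opI h β c s n := repMap_e h g β c s _

theorem rep_z (h g β : κ → ℂ) (c : κ) (s : ℂ) (i : Fin 3) :
    rep h g β c s (HV.z i) = (![∑ c, (1 - 12 * g c ^ 2), s * g c, s ^ 2] i) • 1 :=
  repMap_e h g β c s _

end Fock

/-! ### Spanning the universal Whittaker module by ordered monomials over ℂ[z] -/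

namespace HV

attribute [local instance 100] LieRing.ofAssociativeRing

/-- The canonical map factors through S, and the induced homomorphism into S followed by the
inclusion is the identity by the universal property. -/
theorem universalEnveloping_subalgebra_eq_top {L : Type*} [LieRing L] [LieAlgebra ℂ L]
    {S : Subalgebra ℂ (UniversalEnvelopingAlgebra ℂ L)}
    (hS : ∀ x : L, UniversalEnvelopingAlgebra.ι ℂ x ∈ S) : S = ⊤ := by
  let f : L →ₗ⁅ℂ⁆ S :=
    { toFun := fun x => ⟨UniversalEnvelopingAlgebra.ι ℂ x, hS x⟩
      map_add' := fun x y => Subtype.ext (map_add _ x y)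
      map_smul' := fun t x => Subtype.ext (map_smul _ t x)
      map_lie' := fun {x y} => Subtype.ext ((UniversalEnvelopingAlgebra.ι ℂ).map_lie x y) }
  have hid : S.val.comp (UniversalEnvelopingAlgebra.lift ℂ f) = AlgHom.id ℂ _ := by
    refine UniversalEnvelopingAlgebra.hom_ext ℂ (LieHom.ext fun x => ?_)
    exact congrArg Subtype.val (UniversalEnvelopingAlgebra.lift_ι_apply ℂ f x)
  refine eq_top_iff.mpr fun u _ => ?_
  have h : ((UniversalEnvelopingAlgebra.lift ℂ f u : S) : UniversalEnvelopingAlgebra ℂ L) = u :=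
    congrArg (fun g => g u) hid
  exact h ▸ (UniversalEnvelopingAlgebra.lift ℂ f u).2

/-- Evaluation of polynomials at `z₀, z₁, z₂, z₃`, as an algebra homomorphism. -/
noncomputable def evalZHom : MvPolynomial (Fin 4) ℂ →ₐ[ℂ] U :=
  (Subalgebra.center ℂ U).val.comp (MvPolynomial.aeval zCentral)

theorem evalZHom_comm (p : MvPolynomial (Fin 4) ℂ) (u : U) : evalZHom p * u = u * evalZHom p :=
  (Subalgebra.mem_center_iff.mp (MvPolynomial.aeval zCentral p).2 u).symm

theorem evalZHom_X_zero : evalZHom (X 0) = UniversalEnvelopingAlgebra.ι ℂ (I 0) := by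
  simp [evalZHom, zCentral]

theorem evalZHom_X_succ (i : Fin 3) :
    evalZHom (X i.succ) = UniversalEnvelopingAlgebra.ι ℂ (z i) := by
  simp [evalZHom, zCentral]

/-- The noncentral basis vectors of `𝒱` outside `𝔫⁺`: `I (-(i + 1))` for `(0, i)` and `L (-i)` for
`(1, i)`. -/
noncomputable def lowering (a : Fin 2 × ℕ) : HV :=
  if a.1 = 0 then I (-(a.2 + 1 : ℤ)) else L (-(a.2 : ℤ))

theorem lowering_zero (i : ℕ) : lowering (0, i) = I (-(i + 1 : ℤ)) := rfl

theorem lowering_one (i : ℕ) : lowering (1, i) = L (-(i : ℤ)) := rfl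

/-- No central term arises: opposite modes occur only for L₀ with L₀, where k³ - k vanishes.
Swapping two neighbours in a monomial therefore costs a single shorter monomial. -/
theorem lie_lowering (a b : Fin 2 × ℕ) : ∃ (t : ℂ) (c : Fin 2 × ℕ),
    ⁅lowering a, lowering b⁆ = t • lowering c := by
  obtain ⟨a, i⟩ := a
  obtain ⟨b, j⟩ := b
  have hLI : ∀ i j : ℕ, ∃ t : ℂ, ⁅L (-(i : ℤ)), I (-(j + 1 : ℤ))⁆ = t • lowering (0, i + j) :=
    fun i j => ⟨-((j : ℂ) + 1), by
      rw [lie_L_I, if_neg (by omega), zero_smul, add_zero, lowering_zero]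
      congr 2
      · push_cast; ring
      · push_cast; ring⟩
  fin_cases a <;> fin_cases b
  · refine ⟨0, (0, 0), ?_⟩
    change ⁅I _, I _⁆ = _
    rw [lie_I_I, if_neg (by omega), zero_smul, zero_smul]
  · obtain ⟨t, ht⟩ := hLI j i
    refine ⟨-t, (0, j + i), ?_⟩
    change ⁅I _, L _⁆ = _
    rw [← lie_skew, ht, neg_smul]
  · obtain ⟨t, ht⟩ := hLI i j
    exact ⟨t, _, ht⟩
  · refine ⟨(i : ℂ) - j, (1, i + j), ?_⟩
    change ⁅L (-(i : ℤ)), L (-(j : ℤ))⁆ = _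
    rw [lie_L_L, lowering_one]
    have h : (if -(j : ℤ) = - -(i : ℤ) then (((-(i : ℤ) : ℤ) : ℂ) ^ 3 - (-(i : ℤ) : ℤ)) / 12 else 0)
        = 0 := by
      split_ifs with hij
      · obtain rfl : i = 0 := by omega
        simp
      · rfl
    rw [h, zero_smul, add_zero, show -(i : ℤ) + -(j : ℤ) = -((i + j : ℕ) : ℤ) by push_cast; ring]
    congr 1
    push_cast; ring

variable (ψ : LieAlgebra.LieCharacter ℂ nPlus)

theorem isWhittakerVector_w : IsWhittakerVector ψ (w ψ) := by
  intro x
  have h := (Submodule.Quotient.eq (balancedRelations uPlusMap (CPsi ψ))).mpr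
    (Submodule.subset_span ⟨(1 : U), UniversalEnvelopingAlgebra.ι ℂ x, CPsi.one ψ, rfl⟩)
  rw [one_mul, CPsi.ι_smul, TensorProduct.tmul_smul] at h
  have h2 : uPlusMap (UniversalEnvelopingAlgebra.ι ℂ x)
      = UniversalEnvelopingAlgebra.ι ℂ (x : HV) :=
    UniversalEnvelopingAlgebra.lift_ι_apply ℂ _ x
  rw [h2] at h
  rw [w, ← Submodule.Quotient.mk_smul, TensorProduct.smul_tmul', smul_eq_mul, mul_one]
  exact h

/-- The product of the basis vectors with labels in `l`, applied to `w`. -/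
noncomputable def mon (l : List (Fin 2 × ℕ)) : M ψ :=
  (l.map fun a => UniversalEnvelopingAlgebra.ι ℂ (lowering a)).prod • w ψ

theorem mon_nil : mon ψ [] = w ψ := by simp [mon]

theorem mon_cons (a : Fin 2 × ℕ) (l : List (Fin 2 × ℕ)) :
    mon ψ (a :: l) = UniversalEnvelopingAlgebra.ι ℂ (lowering a) • mon ψ l := by
  simp [mon, mul_smul]

/-- The span of all `p(z) • mon l` for lists of length at most `r`. -/
noncomputable def monSpan (r : ℕ∞) : Submodule ℂ (M ψ) :=
  Submodule.span ℂ {v | ∃ (p : MvPolynomial (Fin 4) ℂ) (l : List (Fin 2 × ℕ)),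
    (l.length : ℕ∞) ≤ r ∧ v = evalZHom p • mon ψ l}

variable {ψ}

theorem evalZHom_smul_mon_mem (p : MvPolynomial (Fin 4) ℂ) {l : List (Fin 2 × ℕ)} {r : ℕ∞}
    (hl : l.length ≤ r) : evalZHom p • mon ψ l ∈ monSpan ψ r :=
  Submodule.subset_span ⟨p, l, hl, rfl⟩

theorem mon_mem {l : List (Fin 2 × ℕ)} {r : ℕ∞} (hl : l.length ≤ r) : mon ψ l ∈ monSpan ψ r := by
  have := evalZHom_smul_mon_mem (ψ := ψ) 1 hl
  rwa [map_one, one_smul] at this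

theorem smul_mem_of_forall_mon {S : Submodule ℂ (M ψ)} {u : U} {r : ℕ∞}
    (h : ∀ (p : MvPolynomial (Fin 4) ℂ) (l : List (Fin 2 × ℕ)), (l.length : ℕ∞) ≤ r →
      u • evalZHom p • mon ψ l ∈ S) {v : M ψ} (hv : v ∈ monSpan ψ r) : u • v ∈ S := by
  have : monSpan ψ r ≤ S.comap (Algebra.lsmul ℂ ℂ (M ψ) u) := by
    refine Submodule.span_le.mpr ?_
    rintro _ ⟨p, l, hl, rfl⟩
    exact h p l hl
  exact this hv

theorem evalZHom_smul_mem (q : MvPolynomial (Fin 4) ℂ) {r : ℕ∞} {v : M ψ}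
    (hv : v ∈ monSpan ψ r) : evalZHom q • v ∈ monSpan ψ r :=
  smul_mem_of_forall_mon (fun p l hl => by
    rw [← mul_smul, ← map_mul]; exact evalZHom_smul_mon_mem _ hl) hv

theorem lowering_smul_mem (a : Fin 2 × ℕ) {r : ℕ∞} {v : M ψ} (hv : v ∈ monSpan ψ r) :
    UniversalEnvelopingAlgebra.ι ℂ (lowering a) • v ∈ monSpan ψ (r + 1) :=
  smul_mem_of_forall_mon (fun p l hl => by
    rw [← mul_smul, ← evalZHom_comm, mul_smul, ← mon_cons]
    refine evalZHom_smul_mon_mem _ ?_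
    rw [List.length_cons]; push_cast; gcongr) hv

theorem mon_sub_mon_mem {l l' : List (Fin 2 × ℕ)} (h : l.Perm l') :
    ∀ r : ℕ, l.length ≤ r + 1 → mon ψ l - mon ψ l' ∈ monSpan ψ r := by
  induction h with
  | nil => intro r _; simp
  | @cons a l l' hl ih =>
    intro r hr
    rcases r with _ | r
    · obtain rfl : l = [] := by simpa using hr
      obtain rfl : l' = [] := by simpa using hl
      simp
    · rw [mon_cons, mon_cons, ← smul_sub]
      exact_mod_cast lowering_smul_mem a (ih r (by simpa using hr))
  | swap a b l =>
    intro r hr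
    obtain ⟨t, c, hc⟩ := lie_lowering b a
    have h := (UniversalEnvelopingAlgebra.ι ℂ).map_lie (lowering b) (lowering a)
    rw [LieRing.of_associative_ring_bracket, hc, map_smul] at h
    rw [mon_cons, mon_cons, mon_cons, mon_cons, ← mul_smul, ← mul_smul, ← sub_smul, ← h,
      smul_assoc, ← mon_cons]
    exact Submodule.smul_mem _ _ (mon_mem (by
      simp only [List.length_cons] at hr ⊢; exact_mod_cast (by omega : l.length + 1 ≤ r)))
  | @trans l₁ l₂ l₃ h₁ h₂ ih₁ ih₂ =>
    intro r hr
    have := Submodule.add_mem _ (ih₁ r hr) (ih₂ r (h₁.length_eq ▸ hr))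
    rwa [sub_add_sub_cancel] at this

/-- Moving x past the first letter leaves a commutator acting on a shorter monomial; the induction
is over all x because that commutator is arbitrary. -/
theorem ι_smul_mon_mem (l : List (Fin 2 × ℕ)) : ∀ x : HV,
    UniversalEnvelopingAlgebra.ι ℂ x • mon ψ l ∈ monSpan ψ ⊤ := by
  induction l with
  | nil =>
    intro x
    have hz : ∀ i, evalZHom (X i) • mon ψ [] ∈ monSpan ψ ⊤ :=
      fun i => evalZHom_smul_mon_mem _ le_top
    induction x using induction_e with
    | zero => simp
    | add x y hx hy => rw [map_add, add_smul]; exact Submodule.add_mem _ hx hy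
    | smul t i =>
      rw [map_smul, smul_assoc]
      refine Submodule.smul_mem _ _ ?_
      have hw : ∀ x : nPlus, UniversalEnvelopingAlgebra.ι ℂ (x : HV) • mon ψ [] ∈ monSpan ψ ⊤ :=
        fun x => by
          rw [mon_nil, isWhittakerVector_w ψ x, ← mon_nil]
          exact Submodule.smul_mem _ _ (mon_mem le_top)
      rcases i with k | k | i
      · rcases lt_or_ge 0 k with hk | hk
        · exact hw (posL k hk)
        · obtain ⟨i, rfl⟩ : ∃ i : ℕ, k = -i := ⟨(-k).toNat, by omega⟩
          change UniversalEnvelopingAlgebra.ι ℂ (lowering (1, i)) • mon ψ [] ∈ _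
          rw [← mon_cons]
          exact mon_mem le_top
      · rcases lt_trichotomy 0 k with hk | rfl | hk
        · exact hw (posI k hk)
        · have := hz 0
          rwa [evalZHom_X_zero] at this
        · obtain ⟨i, rfl⟩ : ∃ i : ℕ, k = -(i + 1) := ⟨(-k - 1).toNat, by omega⟩
          change UniversalEnvelopingAlgebra.ι ℂ (lowering (0, i)) • mon ψ [] ∈ _
          rw [← mon_cons]
          exact mon_mem le_top
      · have := hz i.succ
        rwa [evalZHom_X_succ] at this
  | cons a l ih =>
    intro x
    have h := (UniversalEnvelopingAlgebra.ι ℂ).map_lie x (lowering a)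
    rw [LieRing.of_associative_ring_bracket, eq_sub_iff_add_eq] at h
    rw [mon_cons, ← mul_smul, ← h, add_smul, mul_smul]
    exact Submodule.add_mem _ (ih _) (lowering_smul_mem (r := ⊤) a (ih x))

theorem smul_mem_monSpan (u : U) : ∀ v ∈ monSpan ψ ⊤, u • v ∈ monSpan ψ ⊤ := by
  let S : Subalgebra ℂ U :=
    { carrier := {u | ∀ v ∈ monSpan ψ ⊤, u • v ∈ monSpan ψ ⊤}
      mul_mem' := fun {a b} ha hb v hv => by rw [mul_smul]; exact ha _ (hb _ hv)
      add_mem' := fun {a b} ha hb v hv => by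
        rw [add_smul]; exact Submodule.add_mem _ (ha _ hv) (hb _ hv)
      algebraMap_mem' := fun t v hv => by
        rw [algebraMap_smul]; exact Submodule.smul_mem _ _ hv }
  have hS : S = ⊤ := universalEnveloping_subalgebra_eq_top fun x v hv =>
    smul_mem_of_forall_mon (fun p l _ => by
      rw [← mul_smul, ← evalZHom_comm, mul_smul]
      exact evalZHom_smul_mem _ (ι_smul_mon_mem l x)) hv
  have hu : u ∈ S := hS ▸ Algebra.mem_top
  exact hu

theorem exists_smul_w (v : M ψ) : ∃ u : U, v = u • w ψ := by
  obtain ⟨t, rfl⟩ := Submodule.Quotient.mk_surjective _ v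
  induction t using TensorProduct.induction_on with
  | zero => exact ⟨0, by simp⟩
  | tmul u n =>
    refine ⟨(show ℂ from n) • u, ?_⟩
    rw [w, ← Submodule.Quotient.mk_smul, TensorProduct.smul_tmul', smul_eq_mul, mul_one,
      TensorProduct.smul_tmul]
    congr 2
    exact (mul_one (show ℂ from n)).symm
  | add s t hs ht =>
    obtain ⟨a, ha⟩ := hs
    obtain ⟨b, hb⟩ := ht
    exact ⟨a + b, by rw [Submodule.Quotient.mk_add, ha, hb, add_smul]⟩

theorem monSpan_top : monSpan ψ ⊤ = ⊤ := by
  refine eq_top_iff.mpr fun v _ => ?_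
  obtain ⟨u, rfl⟩ := exists_smul_w v
  exact smul_mem_monSpan u _ (mon_nil ψ ▸ mon_mem le_top)

variable (ψ) in
/-- The combination of ordered monomials applied to `w` with given coefficients, polynomials
in the central elements. -/
noncomputable def ofCoeffs : (Multiset (Fin 2 × ℕ) →₀ MvPolynomial (Fin 4) ℂ) →ₗ[ℂ] M ψ :=
  Finsupp.lsum ℂ fun s => (LinearMap.toSpanSingleton U (M ψ) (mon ψ s.toList)).restrictScalars ℂ
    ∘ₗ evalZHom.toLinearMap

theorem ofCoeffs_single (s : Multiset (Fin 2 × ℕ)) (p : MvPolynomial (Fin 4) ℂ) :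
    ofCoeffs ψ (Finsupp.single s p) = evalZHom p • mon ψ s.toList := by
  simp [ofCoeffs]

/-- Each multiset has one chosen ordering, `toList`; replacing a list by it changes the monomial
only by terms of smaller length. -/
theorem monSpan_le_range_ofCoeffs (r : ℕ) : monSpan ψ r ≤ LinearMap.range (ofCoeffs ψ) := by
  induction r with
  | zero =>
    refine Submodule.span_le.mpr ?_
    rintro _ ⟨p, l, hl, rfl⟩
    obtain rfl : l = [] := by simpa using hl
    exact ⟨Finsupp.single 0 p, by simp [ofCoeffs_single]⟩
  | succ r ih =>
    refine Submodule.span_le.mpr ?_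
    rintro _ ⟨p, l, hl, rfl⟩
    have h1 : evalZHom p • (mon ψ l - mon ψ (l : Multiset (Fin 2 × ℕ)).toList) ∈ monSpan ψ r :=
      evalZHom_smul_mem p (mon_sub_mon_mem (Multiset.coe_eq_coe.mp (Multiset.coe_toList _).symm) r
        (by exact_mod_cast hl))
    have h2 := Submodule.add_mem _ (ih h1)
      (⟨Finsupp.single (l : Multiset (Fin 2 × ℕ)) p, ofCoeffs_single _ _⟩ :
        _ ∈ LinearMap.range (ofCoeffs ψ))
    rwa [smul_sub, sub_add_cancel] at h2

theorem ofCoeffs_surjective : Function.Surjective (ofCoeffs ψ) := by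
  rw [← LinearMap.range_eq_top, ← top_le_iff, ← monSpan_top]
  refine Submodule.span_le.mpr ?_
  rintro _ ⟨p, l, -, rfl⟩
  exact monSpan_le_range_ofCoeffs l.length (evalZHom_smul_mon_mem p le_rfl)

end HV

/-! ### The universal property of `M ψ` and the characters of 𝔫⁺ -/

namespace HV

attribute [local instance 100] LieRing.ofAssociativeRing

/-- The universal property of `M ψ`. -/
theorem exists_intertwiner (ψ : LieAlgebra.LieCharacter ℂ nPlus) {V : Type} [AddCommGroup V]
    [Module ℂ V] (ρ : HV →ₗ⁅ℂ⁆ Module.End ℂ V) (v₀ : V) (hv₀ : ∀ x : nPlus, ρ x v₀ = ψ x • v₀) :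
    ∃ π : M ψ →ₗ[ℂ] V, π (w ψ) = v₀ ∧
      ∀ (u : U) (v : M ψ), π (u • v) = UniversalEnvelopingAlgebra.lift ℂ ρ u (π v) := by
  let R := UniversalEnvelopingAlgebra.lift ℂ ρ
  let S : Subalgebra ℂ UPlus :=
    { carrier := {a | R (uPlusMap a) v₀ = charLift ψ a • v₀}
      mul_mem' := fun {a b} ha hb => by
        simp only [Set.mem_ofPred_eq] at ha hb ⊢
        rw [map_mul, map_mul, map_mul, Module.End.mul_apply, hb, map_smul, ha, smul_smul, mul_comm]
      add_mem' := fun {a b} ha hb => by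
        simp only [Set.mem_ofPred_eq] at ha hb ⊢
        rw [map_add, map_add, map_add, LinearMap.add_apply, ha, hb, add_smul]
      algebraMap_mem' := fun t => by
        simp only [Set.mem_ofPred_eq, AlgHom.commutes, Module.algebraMap_end_apply]
        rfl }
  have hS : S = ⊤ := universalEnveloping_subalgebra_eq_top fun x => by
    change R (uPlusMap (UniversalEnvelopingAlgebra.ι ℂ x)) v₀
      = charLift ψ (UniversalEnvelopingAlgebra.ι ℂ x) • v₀
    have h1 : uPlusMap (UniversalEnvelopingAlgebra.ι ℂ x)
        = UniversalEnvelopingAlgebra.ι ℂ (x : HV) := UniversalEnvelopingAlgebra.lift_ι_apply ℂ _ x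
    have h2 : charLift ψ (UniversalEnvelopingAlgebra.ι ℂ x) = ψ x :=
      UniversalEnvelopingAlgebra.lift_ι_apply ℂ _ x
    have h3 : R (UniversalEnvelopingAlgebra.ι ℂ (x : HV)) = ρ x :=
      UniversalEnvelopingAlgebra.lift_ι_apply ℂ _ _
    rw [h1, h2, h3, hv₀]
  have hchar : ∀ a, R (uPlusMap a) v₀ = charLift ψ a • v₀ := fun a =>
    (hS ▸ Algebra.mem_top : a ∈ S)
  -- With `U` acting on V through ρ, the map can be made `U`-linear, so that its kernel contains the
  -- whole `U`-submodule of relations once it contains the generators.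
  let _ : Module U V := Module.compHom V R.toRingHom
  let val : CPsi ψ →ₗ[ℂ] ℂ := (LinearMap.id : ℂ →ₗ[ℂ] ℂ)
  let F₀ : TensorProduct ℂ U (CPsi ψ) →ₗ[ℂ] V := TensorProduct.lift
    (LinearMap.mk₂ ℂ (fun (u : U) (n : CPsi ψ) => val n • R u v₀)
      (fun a b n => by rw [map_add, LinearMap.add_apply, smul_add])
      (fun t a n => by rw [map_smul, LinearMap.smul_apply, smul_comm])
      (fun a m n => by rw [map_add, add_smul])
      (fun t a n => by rw [map_smul, smul_assoc]))
  have hF₀ : ∀ (u : U) (n : CPsi ψ), F₀ (u ⊗ₜ n) = val n • R u v₀ := fun _ _ => rfl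
  let F : TensorProduct ℂ U (CPsi ψ) →ₗ[U] V :=
    { toFun := F₀
      map_add' := map_add F₀
      map_smul' := fun u t => by
        change F₀ (u • t) = R u (F₀ t)
        induction t using TensorProduct.induction_on with
        | zero => simp
        | tmul a n =>
          rw [TensorProduct.smul_tmul', hF₀, hF₀, (R u).map_smul, smul_eq_mul, map_mul,
            Module.End.mul_apply]
        | add s t hs ht => rw [smul_add, map_add, hs, ht, map_add, map_add] }
  have hF : balancedRelations uPlusMap (CPsi ψ) ≤ LinearMap.ker F := by
    refine Submodule.span_le.mpr ?_
    rintro _ ⟨b, a, n, rfl⟩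
    rw [SetLike.mem_coe, LinearMap.mem_ker, map_sub, sub_eq_zero]
    change F₀ _ = F₀ _
    rw [hF₀, hF₀, map_mul, Module.End.mul_apply, hchar, (R b).map_smul, smul_smul]
    congr 1
    exact mul_comm _ _
  let π := (balancedRelations uPlusMap (CPsi ψ)).liftQ F hF
  have hπ : ∀ (u : U) (v : M ψ), π (u • v) = R u (π v) := fun u v => π.map_smul u v
  refine ⟨{ toFun := π, map_add' := map_add π, map_smul' := fun t v => ?_ }, ?_, hπ⟩
  · have := hπ (algebraMap ℂ U t) v
    rwa [algebraMap_smul, AlgHom.commutes, Module.algebraMap_end_apply] at this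
  · change F₀ ((1 : U) ⊗ₜ CPsi.one ψ) = v₀
    rw [hF₀, map_one]
    exact one_smul ℂ v₀

variable (ψ : LieAlgebra.LieCharacter ℂ nPlus)

/-- Characters kill brackets, and [L₁, L_{k-1}] = (k - 2) L_k with k ≠ 2. -/
theorem character_posL_eq_zero {k : ℤ} (hk : 2 < k) : ψ (posL k (by omega)) = 0 := by
  have h1 : ⁅posL 1 one_pos, posL (k - 1) (by omega)⁆ = ((k : ℂ) - 2) • posL k (by omega) := by
    refine Subtype.ext ?_
    change ⁅L 1, L (k - 1)⁆ = ((k : ℂ) - 2) • L k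
    rw [lie_L_L, if_neg (by omega), zero_smul, add_zero, add_sub_cancel]
    congr 1
    push_cast; ring
  have h2 := LieAlgebra.lieCharacter_apply_lie ψ (posL 1 one_pos) (posL (k - 1) (by omega))
  rw [h1, map_smul, smul_eq_zero] at h2
  refine h2.resolve_left ?_
  rw [sub_eq_zero]
  exact_mod_cast hk.ne'

theorem character_posI_eq_zero {k : ℤ} (hk : 1 < k) : ψ (posI k (by omega)) = 0 := by
  have h1 : ⁅posL 1 one_pos, posI (k - 1) (by omega)⁆ = ((k : ℂ) - 1) • posI k (by omega) := by
    refine Subtype.ext ?_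
    change ⁅L 1, I (k - 1)⁆ = ((k : ℂ) - 1) • I k
    rw [lie_L_I, if_neg (by omega), zero_smul, add_zero, add_sub_cancel]
    congr 1
    push_cast; ring
  have h2 := LieAlgebra.lieCharacter_apply_lie ψ (posL 1 one_pos) (posI (k - 1) (by omega))
  rw [h1, map_smul, smul_eq_zero] at h2
  refine h2.resolve_left ?_
  rw [sub_eq_zero]
  exact_mod_cast hk.ne'

end HV

/-! ### Weight components: Whittaker vectors and leading terms -/

namespace Fock

variable {κ : Type}

theorem component_apply_of_homogeneous {T : Module.End ℂ (Space κ)} {k : ℤ}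
    (hT : ∀ {f : Space κ} {d : ℤ}, IsWeightedHomogeneous (wt κ) f d →
      IsWeightedHomogeneous (wt κ) (T f) (d - k)) (d : ℤ) (f : Space κ) :
    weightedHomogeneousComponent (wt κ) d (T f)
      = T (weightedHomogeneousComponent (wt κ) (d + k) f) := by
  induction f using MvPolynomial.induction_on' with
  | monomial m t =>
    have h := isWeightedHomogeneous_monomial (wt κ) m t rfl
    rw [weightedHomogeneousComponent_of_mem h, weightedHomogeneousComponent_of_mem (hT h)]
    by_cases hd : d + k = Finsupp.weight (wt κ) m
    · rw [if_pos hd, if_pos (by omega)]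
    · rw [if_neg hd, if_neg (by omega), map_zero]
  | add p q hp hq => simp only [map_add, hp, hq]

theorem component_X_mul (a : κ × ℕ) (d : ℤ) (f : Space κ) :
    weightedHomogeneousComponent (wt κ) d (X a * f)
      = X a * weightedHomogeneousComponent (wt κ) (d - wt κ a) f :=
  component_apply_of_homogeneous (T := LinearMap.mulLeft ℂ (X a)) (k := -wt κ a)
    (fun {f e} hf => by
      rw [sub_neg_eq_add, add_comm]
      exact (isWeightedHomogeneous_X ℂ (wt κ) a).mul hf) d f

/-- A polynomial whose components of positive weight satisfy a property that forces the top one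
to vanish has no components of positive weight. -/
theorem component_eq_zero_of_top {f : Space κ}
    (h : ∀ d : ℤ, 0 < d → (∀ e, d < e → weightedHomogeneousComponent (wt κ) e f = 0) →
      weightedHomogeneousComponent (wt κ) d f = 0) (d : ℤ) (hd : 0 < d) :
    weightedHomogeneousComponent (wt κ) d f = 0 := by
  by_contra hne
  have hfin : {e : ℤ | weightedHomogeneousComponent (wt κ) e f ≠ 0}.Finite :=
    weightedHomogeneousComponent_finsupp f
  obtain ⟨e, hde, he⟩ := hfin.exists_le_maximal hne
  refine he.prop (h e (hd.trans_le hde) fun e' hee' => ?_)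
  by_contra hne'
  exact absurd (he.le_of_ge hne' hee'.le) (not_le.mpr hee')

theorem component_eq_zero_of_pderiv {f : Space κ} {d : ℤ} (hd : 0 < d)
    (hf : ∀ a, pderiv a (weightedHomogeneousComponent (wt κ) d f) = 0) :
    weightedHomogeneousComponent (wt κ) d f = 0 := by
  rw [eq_C_of_pderiv_eq_zero hf]
  by_contra hne
  have h1 := weightedHomogeneousComponent_isWeightedHomogeneous (w := wt κ) d f
    (d := 0) (fun h0 => hne (by rw [h0, C_0]))
  rw [map_zero] at h1
  omega

section

variable {h g β : Fin 2 → ℂ} {s : ℂ}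

/-- Whittaker vectors of the Fock space are constants. -/
theorem component_eq_zero_of_whittaker (hβ : β 1 ≠ 0) {f : Space (Fin 2)}
    (hJ : ∀ n : ℤ, 0 < n → J h 0 n f = 0)
    (hL : ∀ n : ℤ, 1 < n → vir h g n f = combJ h β (n - 1) f) (d : ℤ) (hd : 0 < d) :
    weightedHomogeneousComponent (wt (Fin 2)) d f = 0 := by
  refine component_eq_zero_of_top (fun d hd htop => ?_) d hd
  refine component_eq_zero_of_pderiv hd ?_
  have h0 : ∀ n : ℤ, 0 < n → J h 0 n (weightedHomogeneousComponent (wt (Fin 2)) d f) = 0 :=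
    fun n hn => by
      have := component_apply_of_homogeneous (fun hf => isWeightedHomogeneous_J h 0 n hf) (d - n) f
      rw [hJ n hn, map_zero, sub_add_cancel] at this
      exact this.symm
  -- Compare weight d - n in the relation for L_{n+1}. The `vir` side sees only the component of
  -- weight d + 1, which is zero by maximality, while the other side is `combJ` at n on the top
  -- component; boson 0 drops out and β₁ ≠ 0.
  have h1 : ∀ n : ℤ, 0 < n → J h 1 n (weightedHomogeneousComponent (wt (Fin 2)) d f) = 0 :=
    fun n hn => by
      have e1 := component_apply_of_homogeneous
        (fun hf => isWeightedHomogeneous_combJ h β n hf) (d - n) f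
      have e2 := component_apply_of_homogeneous
        (fun hf => isWeightedHomogeneous_vir h g (n + 1) hf) (d - n) f
      rw [hL (n + 1) (by omega), add_sub_cancel_right, e1,
        htop (d - n + (n + 1)) (by omega), map_zero, sub_add_cancel, combJ_apply, Fin.sum_univ_two,
        h0 n hn, smul_zero, zero_add] at e2
      exact (smul_eq_zero.mp e2).resolve_left hβ
  have hp : ∀ c (i : ℕ), J h c (i + 1 : ℤ) (weightedHomogeneousComponent (wt (Fin 2)) d f) = 0 →
      pderiv (c, i) (weightedHomogeneousComponent (wt (Fin 2)) d f) = 0 := fun c i hci => by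
    rw [J_pos] at hci
    exact (smul_eq_zero.mp hci).resolve_left (Nat.cast_add_one_ne_zero _)
  rintro ⟨c, i⟩
  fin_cases c
  · exact hp 0 i (h0 _ (by omega))
  · exact hp 1 i (h1 _ (by omega))

/-- The leading terms of the lowering operators on the Fock space. -/
noncomputable def leading (β : Fin 2 → ℂ) (s : ℂ) (a : Fin 2 × ℕ) : Space (Fin 2) :=
  if a.1 = 0 then s • X (0, a.2) else -∑ c, β c • X (c, a.2)

theorem aeval_leading_injective (hβ : β 1 ≠ 0) (hs : s ≠ 0) :
    Function.Injective (aeval (R := ℂ) (leading β s)) := by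
  -- The substitution is triangular within each mode, with diagonal entries s and -β₁; η inverts it.
  let η : Space (Fin 2) →ₐ[ℂ] Space (Fin 2) := aeval fun a =>
    if a.1 = 0 then s⁻¹ • X (0, a.2) else -(β 1)⁻¹ • (X (1, a.2) + (β 0 * s⁻¹) • X (0, a.2))
  have h : η.comp (aeval (leading β s)) = AlgHom.id ℂ _ := by
    refine MvPolynomial.algHom_ext fun a => ?_
    obtain ⟨c, i⟩ := a
    rw [AlgHom.comp_apply, aeval_X, AlgHom.id_apply]
    fin_cases c
    · simp [leading, η, smul_smul, hs]
    · simp [leading, η, smul_smul, hβ, Fin.sum_univ_two]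
  intro p q hpq
  have := congrArg η hpq
  rwa [← AlgHom.comp_apply, ← AlgHom.comp_apply, h] at this

/-- In L_{-i} the part `vir` raises weight by i, but the shift term -∑ β_c J_c(-i - 1) raises it by
i + 1 and dominates. The hypothesis on f discards the former, so even L₀ acts to leading order as
multiplication by a linear form. -/
theorem component_rep_lowering (d : ℤ) (a : Fin 2 × ℕ) (f : Space (Fin 2))
    (hf : weightedHomogeneousComponent (wt (Fin 2)) (d - a.2) f = 0) :
    weightedHomogeneousComponent (wt (Fin 2)) d (rep h g β 0 s (HV.lowering a) f)
      = leading β s a * weightedHomogeneousComponent (wt (Fin 2)) (d - (a.2 + 1)) f := by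
  obtain ⟨c, i⟩ := a
  fin_cases c
  · change weightedHomogeneousComponent _ d (rep h g β 0 s (HV.lowering (0, i)) f) = _
    rw [HV.lowering_zero, rep_I, opI_apply, J_neg, if_neg (by omega), zero_smul, add_zero,
      map_smul, component_X_mul]
    simp [leading, wt]
  · change weightedHomogeneousComponent _ d (rep h g β 0 s (HV.lowering (1, i)) f) = _
    rw [HV.lowering_one, rep_L, opL_apply, if_neg (by omega), zero_smul, sub_zero, map_sub,
      component_apply_of_homogeneous (fun hf => isWeightedHomogeneous_vir h g (-(i : ℤ)) hf),
      ← sub_eq_add_neg, hf, map_zero, zero_sub, combJ_apply,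
      show -(i : ℤ) - 1 = -(i + 1) by ring]
    simp only [J_neg, map_sum, map_smul, component_X_mul]
    change _ = (-∑ c, β c • X (c, i)) * _
    simp only [wt, neg_mul, Finset.sum_mul, smul_mul_assoc]

/-- The product of the lowering operators with labels in `l`, applied to the vacuum. -/
noncomputable def vacMon (h g β : Fin 2 → ℂ) (s : ℂ) (l : List (Fin 2 × ℕ)) : Space (Fin 2) :=
  (l.map fun a => rep h g β 0 s (HV.lowering a)).prod 1

theorem component_vacMon (l : List (Fin 2 × ℕ)) : ∀ d : ℤ, (l.map (wt (Fin 2))).sum ≤ d →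
    weightedHomogeneousComponent (wt (Fin 2)) d (vacMon h g β s l)
      = if d = (l.map (wt (Fin 2))).sum then (l.map (leading β s)).prod else 0 := by
  induction l with
  | nil =>
    intro d _
    have h1 : (1 : Space (Fin 2)) ∈ weightedHomogeneousSubmodule ℂ (wt (Fin 2)) 0 :=
      isWeightedHomogeneous_one _ _
    simpa [vacMon] using weightedHomogeneousComponent_of_mem (m := d) h1
  | cons a l ih =>
    intro d hd
    rw [List.map_cons, List.sum_cons] at hd ⊢
    have hv : vacMon h g β s (a :: l) = rep h g β 0 s (HV.lowering a) (vacMon h g β s l) := by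
      simp [vacMon]
    have hw : wt (Fin 2) a = a.2 + 1 := rfl
    rw [hv, component_rep_lowering, ih _ (by omega), List.map_cons, List.prod_cons]
    · split_ifs <;> first | (exfalso; omega) | simp
    · rw [ih _ (by omega), if_neg (by omega)]

theorem prod_map_X (t : Multiset (Fin 2 × ℕ)) :
    (t.map (X : Fin 2 × ℕ → Space (Fin 2))).prod = monomial (Multiset.toFinsupp t) 1 := by
  induction t using Multiset.induction_on with
  | empty => simp
  | cons a t ih =>
    rw [Multiset.map_cons, Multiset.prod_cons, ih, X, monomial_mul, one_mul,
      ← Multiset.singleton_add, map_add, Multiset.toFinsupp_singleton]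

theorem wt_sum_pos {t : Multiset (Fin 2 × ℕ)} (ht : t ≠ 0) : 0 < (t.map (wt (Fin 2))).sum := by
  have hnn : ∀ t : Multiset (Fin 2 × ℕ), 0 ≤ (t.map (wt (Fin 2))).sum := fun t =>
    Multiset.sum_nonneg fun x hx => by
      obtain ⟨a, -, rfl⟩ := Multiset.mem_map.mp hx
      simp only [wt]; positivity
  obtain ⟨a, ha⟩ := Multiset.exists_mem_of_ne_zero ht
  obtain ⟨t, rfl⟩ := Multiset.exists_cons_of_mem ha
  rw [Multiset.map_cons, Multiset.sum_cons]
  have := hnn t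
  simp only [wt] at this ⊢
  positivity

/-- If a combination of monomials applied to the vacuum has no components of positive weight, then
only the empty monomial occurs. -/
theorem coeff_eq_zero_of_component (hβ : β 1 ≠ 0) (hs : s ≠ 0)
    (γ : Multiset (Fin 2 × ℕ) →₀ ℂ)
    (hγ : ∀ d : ℤ, 0 < d → weightedHomogeneousComponent (wt (Fin 2)) d
      (γ.sum fun t x => x • vacMon h g β s t.toList) = 0) {t : Multiset (Fin 2 × ℕ)} (ht : t ≠ 0) :
    γ t = 0 := by
  by_contra hne
  let W : Multiset (Fin 2 × ℕ) → ℤ := fun t => (t.map (wt (Fin 2))).sum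
  -- In the largest weight occurring, only leading terms contribute. They form the image of a
  -- polynomial under an injective substitution, and the coefficient of t₀ in that polynomial is γ
  -- t₀.
  obtain ⟨t₀, ht₀, hmax⟩ := γ.support.exists_max_image W ⟨t, Finsupp.mem_support_iff.mpr hne⟩
  have hpos : 0 < W t₀ := (wt_sum_pos ht).trans_le (hmax t (Finsupp.mem_support_iff.mpr hne))
  have h1 := hγ (W t₀) hpos
  have hcomp : ∀ t ∈ γ.support, weightedHomogeneousComponent (wt (Fin 2)) (W t₀)
      (γ t • vacMon h g β s t.toList)
      = aeval (leading β s) (if W t₀ = W t then monomial (Multiset.toFinsupp t) (γ t) else 0) := by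
    intro t ht
    have hW : (t.toList.map (wt (Fin 2))).sum = W t := by
      rw [← Multiset.sum_coe, ← Multiset.map_coe, Multiset.coe_toList]
    rw [map_smul, component_vacMon _ _ (hW ▸ hmax t ht), hW]
    split_ifs
    · have : monomial (Multiset.toFinsupp t) (γ t)
          = γ t • (t.map (X : Fin 2 × ℕ → Space (Fin 2))).prod := by
        rw [prod_map_X, smul_monomial, smul_eq_mul, mul_one]
      rw [this, map_smul, map_multiset_prod, Multiset.map_map, ← Multiset.prod_coe,
        ← Multiset.map_coe, Multiset.coe_toList]
      simp
    · simp
  rw [Finsupp.sum, map_sum, Finset.sum_congr rfl hcomp, ← map_sum] at h1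
  have h2 := congrArg (coeff (Multiset.toFinsupp t₀))
    (aeval_leading_injective hβ hs (h1.trans (map_zero _).symm))
  rw [coeff_sum, Finset.sum_eq_single t₀, if_pos rfl, coeff_monomial, if_pos rfl, coeff_zero] at h2
  · exact Finsupp.mem_support_iff.mp ht₀ h2
  · intro t _ htt
    split_ifs
    · rw [coeff_monomial, if_neg fun h => htt (Multiset.toFinsupp.injective h)]
    · rw [coeff_zero]
  · exact fun h => absurd ht₀ h

end

end Fock

/-! ### Matching the parameters with ψ and the central character -/

namespace Fock

attribute [local instance 100] LieRing.ofAssociativeRing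

theorem opL_one (h g β : Fin 2 → ℂ) {n : ℤ} (hn : 0 < n) :
    opL h g β n 1 = ((if n = 1 then -∑ c, β c * h c else 0)
      + if n = 2 then -(∑ c, β c ^ 2) / 2 else 0) • (1 : Space (Fin 2)) := by
  rw [opL_apply, vir_pos_one h g hn, combJ_apply, zero_sub]
  by_cases h1 : n = 1
  · subst h1
    rw [if_pos rfl, if_neg (by norm_num), if_neg (by norm_num), zero_smul, sub_zero, add_zero]
    simp only [sub_self, J_zero, smul_smul, ← Finset.sum_smul, neg_smul]
  · simp only [J_pos_one h _ (show 0 < n - 1 by omega), if_neg h1]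
    split_ifs
    · rw [neg_div]; simp
    · simp

theorem opI_one (h β : Fin 2 → ℂ) (c : Fin 2) (s : ℂ) {n : ℤ} (hn : 0 < n) :
    opI h β c s n 1 = (if n = 1 then s * β c else 0) • (1 : Space (Fin 2)) := by
  rw [opI_apply, J_pos_one h c hn, zero_add, smul_smul, mul_ite, mul_zero]

/-- Seven equations for seven unknowns: s is a square root of ξ₃ and fixes h₀, g₀, β₀. The second
boson supplies the rest: β₁ from a₂, g₁ from the central charge, and h₁ from a₁ after division by
β₁. Since s²β₁² = -(b² + 2a₂ξ₃), the last hypothesis is exactly β₁ ≠ 0. -/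
theorem exists_parameters (a₁ a₂ b : ℂ) (ξ : Fin 4 → ℂ) (hξ : ξ 3 ≠ 0)
    (hab : b ^ 2 + 2 * a₂ * ξ 3 ≠ 0) :
    ∃ (h g β : Fin 2 → ℂ) (s : ℂ), s ≠ 0 ∧ β 1 ≠ 0 ∧
      (s * h 0 = ξ 0 ∧ ∑ c, (1 - 12 * g c ^ 2) = ξ 1 ∧ s * g 0 = ξ 2 ∧ s ^ 2 = ξ 3) ∧
      -∑ c, β c * h c = a₁ ∧ -(∑ c, β c ^ 2) / 2 = a₂ ∧ s * β 0 = b := by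
  obtain ⟨s, hs⟩ := IsAlgClosed.exists_pow_nat_eq (ξ 3) two_pos
  have hs0 : s ≠ 0 := fun h0 => hξ (by rw [← hs, h0]; ring)
  obtain ⟨t, ht⟩ := IsAlgClosed.exists_pow_nat_eq (-2 * a₂ - (b / s) ^ 2) two_pos
  have ht0 : t ≠ 0 := fun h0 => hab (by
    rw [h0] at ht
    field_simp at ht
    rw [← hs]
    linear_combination ht)
  obtain ⟨r, hr⟩ := IsAlgClosed.exists_pow_nat_eq ((2 - ξ 1) / 12 - (ξ 2 / s) ^ 2) two_pos
  refine ⟨![ξ 0 / s, (-a₁ - b / s * (ξ 0 / s)) / t], ![ξ 2 / s, r], ![b / s, t], s, hs0, ht0,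
    ⟨?_, ?_, ?_, hs⟩, ?_, ?_, ?_⟩ <;> simp only [Fin.sum_univ_two, Matrix.cons_val]
  · field_simp
  · rw [hr]; ring
  · field_simp
  · rw [mul_div_cancel₀ _ ht0]; ring
  · rw [ht]; ring
  · field_simp

theorem lift_rep_evalZHom (h g β : Fin 2 → ℂ) (s : ℂ) (ξ : Fin 4 → ℂ)
    (hξ : s * h 0 = ξ 0 ∧ ∑ c, (1 - 12 * g c ^ 2) = ξ 1 ∧ s * g 0 = ξ 2 ∧ s ^ 2 = ξ 3)
    (p : MvPolynomial (Fin 4) ℂ) :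
    UniversalEnvelopingAlgebra.lift ℂ (rep h g β 0 s) (HV.evalZHom p)
      = algebraMap ℂ (Module.End ℂ (Space (Fin 2))) (eval ξ p) := by
  have hhom : (UniversalEnvelopingAlgebra.lift ℂ (rep h g β 0 s)).comp HV.evalZHom
      = (Algebra.ofId ℂ (Module.End ℂ (Space (Fin 2)))).comp (aeval ξ) := by
    refine MvPolynomial.algHom_ext fun i => ?_
    simp only [AlgHom.comp_apply, aeval_X, Algebra.ofId_apply]
    refine Fin.cases ?_ (fun i => ?_) i
    · rw [HV.evalZHom_X_zero, UniversalEnvelopingAlgebra.lift_ι_apply, rep_I]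
      refine LinearMap.ext fun f => ?_
      rw [opI_apply, J_zero, if_neg (by norm_num), zero_smul, add_zero, smul_smul, hξ.1]
      rfl
    · rw [HV.evalZHom_X_succ, UniversalEnvelopingAlgebra.lift_ι_apply, rep_z,
        Algebra.algebraMap_eq_smul_one]
      congr 1
      fin_cases i
      · exact hξ.2.1
      · exact hξ.2.2.1
      · exact hξ.2.2.2
  exact congrArg (fun f => f p) hhom

end Fock

/-! ### Specialisation at a generic central character -/

namespace HV

attribute [local instance 100] LieRing.ofAssociativeRing

open Fock

theorem rep_eq_character_smul {ψ : LieAlgebra.LieCharacter ℂ nPlus} {h g β : Fin 2 → ℂ} {s : ℂ}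
    (h1 : -∑ c, β c * h c = ψ (posL 1 one_pos)) (h2 : -(∑ c, β c ^ 2) / 2 = ψ (posL 2 two_pos))
    (h3 : s * β 0 = ψ (posI 1 one_pos)) (x : nPlus) :
    rep h g β 0 s x 1 = ψ x • (1 : Space (Fin 2)) := by
  obtain ⟨x, hx⟩ := x
  induction hx using Submodule.span_induction with
  | mem x hx =>
    obtain ⟨k, hk, rfl | rfl⟩ := hx
    · change rep h g β 0 s (L k) 1 = ψ (posL k hk) • 1
      rw [rep_L, opL_one h g β hk]
      congr 1
      split_ifs with k1 k2 k2
      · omega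
      · subst k1; rw [add_zero]; exact h1
      · subst k2; rw [zero_add]; exact h2
      · rw [character_posL_eq_zero ψ (by omega), add_zero]
    · change rep h g β 0 s (I k) 1 = ψ (posI k hk) • 1
      rw [rep_I, opI_one h β 0 s hk]
      congr 1
      split_ifs with k1
      · subst k1; exact h3
      · rw [character_posI_eq_zero ψ (by omega)]
  | zero =>
    change rep h g β 0 s (0 : HV) 1 = ψ 0 • 1
    simp
  | add x y hx hy hx' hy' =>
    change rep h g β 0 s (x + y) 1 = ψ (⟨x, hx⟩ + ⟨y, hy⟩) • 1
    rw [map_add, map_add, LinearMap.add_apply, hx', hy', add_smul]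
  | smul t x hx hx' =>
    change rep h g β 0 s (t • x) 1 = ψ (t • ⟨x, hx⟩) • 1
    rw [map_smul, map_smul, LinearMap.smul_apply, hx', smul_assoc]

/-- At a generic point of the spectrum of `ℂ[z]`, the coefficients of a Whittaker vector vanish,
except for the one of the empty monomial. -/
theorem eval_coeff_eq_zero {ψ : LieAlgebra.LieCharacter ℂ nPlus}
    {G : Multiset (Fin 2 × ℕ) →₀ MvPolynomial (Fin 4) ℂ} (hG : IsWhittakerVector ψ (ofCoeffs ψ G))
    {ξ : Fin 4 → ℂ} (hξ : ξ 3 ≠ 0)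
    (hξ' : ψ (posI 1 one_pos) ^ 2 + 2 * ψ (posL 2 two_pos) * ξ 3 ≠ 0)
    {t : Multiset (Fin 2 × ℕ)} (ht : t ≠ 0) : eval ξ (G t) = 0 := by
  obtain ⟨h, g, β, s, hs, hβ, hz, h1, h2, h3⟩ :=
    exists_parameters (ψ (posL 1 one_pos)) _ _ ξ hξ hξ'
  obtain ⟨π, hπw, hπ⟩ := exists_intertwiner ψ (rep h g β 0 s) 1 (rep_eq_character_smul h1 h2 h3)
  have hρ : ∀ x : nPlus, rep h g β 0 s x (π (ofCoeffs ψ G)) = ψ x • π (ofCoeffs ψ G) := fun x => by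
    rw [← map_smul, ← hG x, hπ, UniversalEnvelopingAlgebra.lift_ι_apply]
  have hmon : ∀ l, π (mon ψ l) = vacMon h g β s l := fun l => by
    rw [mon, hπ, hπw, map_list_prod, List.map_map, vacMon]
    congr 3
    ext1 a
    exact UniversalEnvelopingAlgebra.lift_ι_apply ℂ _ _
  let γ : Multiset (Fin 2 × ℕ) →₀ ℂ := G.mapRange (eval ξ) (map_zero _)
  have hγ : π (ofCoeffs ψ G) = γ.sum fun t x => x • vacMon h g β s t.toList := by
    have hsum : (γ.sum fun t x => x • vacMon h g β s t.toList)
        = G.sum fun t p => eval ξ p • vacMon h g β s t.toList :=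
      Finsupp.sum_mapRange_index fun _ => zero_smul _ _
    rw [hsum]
    conv_lhs => rw [← G.sum_single]
    rw [Finsupp.sum, map_sum, map_sum]
    refine Finset.sum_congr rfl fun t _ => ?_
    rw [ofCoeffs_single, hπ, lift_rep_evalZHom h g β s ξ hz, hmon, Module.algebraMap_end_apply]
  refine coeff_eq_zero_of_component (h := h) (g := g) hβ hs γ (fun d hd => ?_) ht
  rw [← hγ]
  refine component_eq_zero_of_whittaker (h := h) (g := g) hβ (fun n hn => ?_) (fun n hn => ?_) d hd
  · have e := hρ (posI n hn)
    change rep h g β 0 s (I n) _ = _ at e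
    have e1 := rep_eq_character_smul (g := g) h1 h2 h3 (posI n hn)
    change rep h g β 0 s (I n) 1 = _ at e1
    rw [rep_I, opI_one h β 0 s hn] at e1
    -- The vacuum identifies ψ(I_n) with the scalar part of `opI`; subtracting it leaves J₀(n)
    -- annihilating the image. The same is done below for L_n with n > 1.
    have e2 := smul_left_injective ℂ (one_ne_zero : (1 : Space (Fin 2)) ≠ 0) e1
    rw [rep_I, opI_apply, ← e2, smul_add, smul_smul, mul_ite, mul_zero, add_eq_right] at e
    exact (smul_eq_zero.mp e).resolve_left hs
  · have hn0 : 0 < n := by omega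
    have e := hρ (posL n hn0)
    change rep h g β 0 s (L n) _ = _ at e
    have e1 := rep_eq_character_smul (g := g) h1 h2 h3 (posL n hn0)
    change rep h g β 0 s (L n) 1 = _ at e1
    rw [rep_L, opL_one h g β hn0] at e1
    have e2 := smul_left_injective ℂ (one_ne_zero : (1 : Space (Fin 2)) ≠ 0) e1
    rw [rep_L, opL_apply, ← e2, if_neg hn.ne', zero_add] at e
    have e3 : (if n = 2 then -(∑ c, β c ^ 2) / 2 else 0)
        = -(if n = 2 then (∑ c, β c ^ 2) / 2 else 0) := by
      split_ifs <;> ring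
    rw [e3, neg_smul, sub_eq_neg_self, sub_eq_zero] at e
    exact e

end HV

/-! ### Conclusion by Zariski density -/

theorem proposition3p4 (ψ : LieAlgebra.LieCharacter ℂ HV.nPlus) (hψ : HV.IsNonsingular ψ)
    (w' : HV.M ψ) (hw' : HV.IsWhittakerVector ψ w') :
    ∃ p : MvPolynomial (Fin 4) ℂ, w' = HV.evalZ p • HV.w ψ := by
  obtain ⟨G, rfl⟩ := HV.ofCoeffs_surjective w'
  have hb : ψ (HV.posI 1 one_pos) ≠ 0 := hψ.2.2
  -- The generic points are those where q ≠ 0. At the origin its second factor equals ψ(I₁)² ≠ 0, so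
  -- q is not the zero polynomial.
  let q : MvPolynomial (Fin 4) ℂ := X 3 *
    (C (ψ (HV.posI 1 one_pos) ^ 2) + C (2 * ψ (HV.posL 2 two_pos)) * X 3)
  have hq : q ≠ 0 := by
    refine mul_ne_zero (X_ne_zero _) fun h => ?_
    have h0 := congrArg (eval 0) h
    simp only [map_add, map_mul, eval_C, eval_X, Pi.zero_apply, mul_zero, add_zero, map_zero] at h0
    exact pow_ne_zero 2 hb h0
  have hG : ∀ t ≠ 0, G t = 0 := fun t ht => by
    -- The product of `G t` and q vanishes at every point, hence is zero in an integral domain.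
    refine (mul_eq_zero.mp ?_).resolve_right hq
    refine MvPolynomial.funext fun ξ => ?_
    rw [map_mul, map_zero, mul_eq_zero, or_iff_not_imp_right]
    intro hξ
    simp only [q, map_mul, map_add, eval_X, eval_C, mul_ne_zero_iff, ← ne_eq] at hξ
    exact HV.eval_coeff_eq_zero hw' hξ.1 hξ.2 ht
  refine ⟨G 0, ?_⟩
  have hG0 : G = Finsupp.single 0 (G 0) := by
    ext1 t
    by_cases ht : t = 0
    · rw [ht, Finsupp.single_eq_same]
    · rw [hG t ht, Finsupp.single_eq_of_ne ht]
  conv_lhs => rw [hG0, HV.ofCoeffs_single, Multiset.toList_zero, HV.mon_nil]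
  rfl
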